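/- **Setting.** For each $M\ge 1$ consider a panel dataset with $N$ units, $T$ times and a labelled partition $C_1,\dots,C_M$ of the units into clusters, following the model $Y_{i,t}=\beta^\star Z_{i,t}+X_{i,t}^\top\gamma+\epsilon_{i,t}$. The covariate $Z\in\mathbb R^{N\times T}$, the controls $X^{(1)},\dots,X^{(K)}\in\mathbb R^{N\times T}$, the coefficients $\beta^\star,\gamma$, and a symmetric matrix $P\in\mathbb R^{T\times T}$ with $P^2=I_T$ are nonrandom; all of these, the dimensions $N,T,K$, the clusters and the law of the errors may change arbitrarily with $M$ (so $\beta^\star=\beta^{(\star,M)}$). The errors $\epsilon^{(M)}$, $M\ge1$, are random matrices on one probability space. Write $V_{C_m}$ for the rows of $V$ in $C_m$, and $\langle V,W\rangle=\sum_{i,t}V_{i,t}W_{i,t}$. For $V\in\mathbb R^{N\times T}$ let $\mathrm{MosaicResid}(V,X)\in\mathbb R^{N\times T}$ be the matrix whose rows in $C_m$ are the OLS residuals of $V_{C_m}$ regressed, using cluster $m$ only, on the $2K$ regressors $X^{(k)}_{C_m}$, $X^{(k)}_{C_m}P$. Let $B_1,\dots,B_M$ be i.i.d. Bernoulli$(1/2)$,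 independent of the data, and let $\mathrm{MosaicRandomize}(V)$ be the matrix with rows $V_{C_m}P^{B_m}$ in $C_m$. Put $A=\mathrm{MosaicResid}(Z,X)$, $D=\tfrac12(A-AP)$, $S(V)=\langle D,V\rangle/\langle D,D\rangle$, $\hat e=\mathrm{MosaicResid}(Y,X)$, $\hat\beta=S(\hat e)$, $\tilde\beta=S(\mathrm{MosaicRandomize}(\hat e))$, and, with $\tilde D=\mathrm{MosaicRandomize}(D)$ (same $B_m$), $\tilde\rho=\langle D,\tilde D\rangle/\sqrt{\langle D,D\rangle\langle\tilde D,\tilde D\rangle}$. The mosaic confidence interval is $$\mathrm{CI}_{\mathrm{mosaic}}^{(M)}=\Big[\hat\beta+\tilde Q_{\alpha/2}\Big(\tfrac{\tilde\rho\hat\beta-\tilde\beta}{1-\tilde\rho}\Big),\ \hat\beta+\tilde Q_{1-\alpha/2}\Big(\tfrac{\tilde\rho\hat\beta-\tilde\beta}{1-\tilde\rho}\Big)\Big],$$ where $\tilde Q_p$ is any (measurably chosen) $p$-quantile of the law over $B_1,\dots,B_M$ conditional on the data, and the fraction is read as $0$ when $\tilde\rho=1$. Finally let $\hat\epsilon=\mathrm{MosaicResid}(Y-\beta^\star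 Z,X)$ and $\hat\theta_m=\langle (A-AP)_{C_m},\hat\epsilon_{C_m}\rangle-\langle (A-AP)_{C_m},\hat\epsilon_{C_m}P\rangle$ for $m\le M$. **Theorem (Robust CIs).** Let $\alpha\in(0,1)$. Assume that 1. $\mathbb E[\epsilon^{(M)}]=0$ for every $M$; 2. $\epsilon^{(M)}_{C_1},\dots,\epsilon^{(M)}_{C_M}$ are jointly independent for every $M$; 3. for some $\delta>0$, with $\sigma_M^2=\sum_{m\le M}\mathrm{Var}(\hat\theta_m)$, we have $\sigma_M^{-(2+\delta)}\sum_{m\le M}\mathbb E|\hat\theta_m|^{2+\delta}\to0$ as $M\to\infty$; moreover, for some $\delta_1>\delta$, $\mathbb E|\hat\theta_m|^{2+\delta_1}$ is finite and bounded uniformly in $m\le M$ and $M$, and $\mathrm{Var}(\hat\theta_m)$ is bounded below by a positive constant uniformly in $m\le M$ and $M$. Then, with no invariance assumption on the law of the errors, $$\liminf_{M\to\infty}\mathbb P\big(\beta^\star\in \mathrm{CI}^{(M)}_{\mathrm{mosaic}}\big)\ge 1-\alpha .$$ -/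

import Mathlib

open MeasureTheory ProbabilityTheory Filter

noncomputable section

namespace Mosaic

/-- Panel data `Y i t = β * Z i t + ∑ k, γ k * X k i t + ε i t` with `N` units, `T` times, `K`
controls and units divided into clusters `C_m = {i | cluster i = m}`, `m : Fin M`. The covariates,
the coefficients, the clusters and the transformation `P` are nonrandom; the errors `ε` are
random. -/
structure PanelModel (Ω : Type*) (M : ℕ) where
  N : ℕ
  T : ℕ
  K : ℕ
  cluster : Fin N → Fin M
  P : Matrix (Fin T) (Fin T) ℝ
  Z : Matrix (Fin N) (Fin T) ℝ
  X : Fin K → Matrix (Fin N) (Fin T) ℝ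
  β : ℝ
  γ : Fin K → ℝ
  ε : Ω → Matrix (Fin N) (Fin T) ℝ

section Resid

variable {N T K M : ℕ} (c : Fin N → Fin M)

/-- The inner product `⟨A, B⟩ = ∑_{i,t} A_{i,t} B_{i,t}`. -/
def frob (A B : Matrix (Fin N) (Fin T) ℝ) : ℝ :=
  ∑ i, ∑ t, A i t * B i t

/-- The inner product `⟨A_{C_m}, B_{C_m}⟩` of the rows that belong to cluster `m`. -/
def clusterFrob (m : Fin M) (A B : Matrix (Fin N) (Fin T) ℝ) : ℝ :=
  ∑ i with c i = m, ∑ t, A i t * B i t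

/-- The submatrix `V_{C_m}`, as a vector of the Euclidean space `ℝ^{C_m × [T]}`. -/
def clusterVec (m : Fin M) (V : Matrix (Fin N) (Fin T) ℝ) :
    EuclideanSpace ℝ ({i : Fin N // c i = m} × Fin T) :=
  WithLp.toLp 2 fun p => V p.1 p.2

/-- Column space of the invariance-augmented design of cluster `m`: the span of the controls `X k`
and of the transformed controls `X k * P`, restricted to the cluster. -/
def clusterDesign (P : Matrix (Fin T) (Fin T) ℝ) (X : Fin K → Matrix (Fin N) (Fin T) ℝ)
    (m : Fin M) : Submodule ℝ (EuclideanSpace ℝ ({i : Fin N // c i = m} × Fin T)) :=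
  Submodule.span ℝ ((Set.range fun k => clusterVec c m (X k)) ∪
    (Set.range fun k => clusterVec c m (X k * P)))

/-- OLS residuals of `V_{C_m}` on the augmented design of cluster `m`: the vector minus its
least-squares fit. -/
def clusterResid (P : Matrix (Fin T) (Fin T) ℝ) (X : Fin K → Matrix (Fin N) (Fin T) ℝ)
    (V : Matrix (Fin N) (Fin T) ℝ) (m : Fin M) :
    EuclideanSpace ℝ ({i : Fin N // c i = m} × Fin T) :=
  clusterVec c m V - (clusterDesign c P X m).starProjection (clusterVec c m V)

/-- `MosaicResid(V, X)`: the concatenation of the cluster-by-cluster OLS residuals. -/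
def mosaicResid (P : Matrix (Fin T) (Fin T) ℝ) (X : Fin K → Matrix (Fin N) (Fin T) ℝ)
    (V : Matrix (Fin N) (Fin T) ℝ) : Matrix (Fin N) (Fin T) ℝ :=
  Matrix.of fun i t => clusterResid c P X V (c i) (⟨i, rfl⟩, t)

/-- `MosaicRandomize(E)` for given bits `B`: the rows `E_{C_m}` are replaced by
`E_{C_m} P^{B_m}`. -/
def mosaicRandomize (P : Matrix (Fin T) (Fin T) ℝ) (E : Matrix (Fin N) (Fin T) ℝ)
    (B : Fin M → Bool) : Matrix (Fin N) (Fin T) ℝ :=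
  Matrix.of fun i t => (E * P ^ (B (c i)).toNat) i t

end Resid

/-- The joint law of independent `B_1, …, B_M ~ Bernoulli(1/2)`. -/
def bitLaw (M : ℕ) : Measure (Fin M → Bool) :=
  Measure.pi fun _ => bernoulliMeasure true false ⟨1 / 2, by norm_num, by norm_num⟩

/-- `q` is a `p`-quantile of the distribution `ν`. -/
def IsQuantile (ν : Measure ℝ) (p q : ℝ) : Prop :=
  ν.real (Set.Iio q) ≤ p ∧ p ≤ ν.real (Set.Iic q)

namespace PanelModel

variable {Ω : Type*} {M : ℕ} (d : PanelModel Ω M)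

/-- The outcomes. -/
def Y (ω : Ω) : Matrix (Fin d.N) (Fin d.T) ℝ :=
  d.β • d.Z + ∑ k, d.γ k • d.X k + d.ε ω

/-- `A = MosaicResid(Z, X)`. -/
def A : Matrix (Fin d.N) (Fin d.T) ℝ := mosaicResid d.cluster d.P d.X d.Z

/-- `D = (A - A P) / 2`. -/
def D : Matrix (Fin d.N) (Fin d.T) ℝ := (1 / 2 : ℝ) • (d.A - d.A * d.P)

/-- The test statistic `S(E) = ⟨D, E⟩ / ⟨D, D⟩`. -/
def S (E : Matrix (Fin d.N) (Fin d.T) ℝ) : ℝ := frob d.D E / frob d.D d.D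

/-- The residuals `MosaicResid(Y, X)`. -/
def resid (ω : Ω) : Matrix (Fin d.N) (Fin d.T) ℝ := mosaicResid d.cluster d.P d.X (d.Y ω)

/-- The mosaic estimator of `β`. -/
def betaHat (ω : Ω) : ℝ := d.S (d.resid ω)

/-- The estimator computed from the randomized residuals, for given bits. -/
def betaTilde (ω : Ω) (B : Fin M → Bool) : ℝ :=
  d.S (mosaicRandomize d.cluster d.P (d.resid ω) B)

/-- The angle between `D` and `MosaicRandomize(D)`, for given bits. -/
def rhoTilde (B : Fin M → Bool) : ℝ :=
  frob d.D (mosaicRandomize d.cluster d.P d.D B) /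
    √(frob d.D d.D *
      frob (mosaicRandomize d.cluster d.P d.D B) (mosaicRandomize d.cluster d.P d.D B))

/-- The law of `(ρ̃ β̂ - β̃) / (1 - ρ̃)` conditional on the data, that is, over the bits only. -/
def condLaw (ω : Ω) : Measure ℝ :=
  (bitLaw M).map fun B =>
    (d.rhoTilde B * d.betaHat ω - d.betaTilde ω B) / (1 - d.rhoTilde B)

/-- The mosaic interval `[β̂ + qlo, β̂ + qhi]`; at level `1 - α`, `qlo` and `qhi` are an
`α / 2`-quantile and a `1 - α / 2`-quantile of `condLaw`. -/
def mosaicCI (ω : Ω) (qlo qhi : ℝ) : Set ℝ :=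
  Set.Icc (d.betaHat ω + qlo) (d.betaHat ω + qhi)

/-- The oracle mosaic residuals `MosaicResid(Y - β Z, X)`. -/
def oracleResid (ω : Ω) : Matrix (Fin d.N) (Fin d.T) ℝ :=
  mosaicResid d.cluster d.P d.X (d.Y ω - d.β • d.Z)

/-- The cluster statistic `⟨D'_{C_m}, ε̂_{C_m}⟩ - ⟨D'_{C_m}, ε̂_{C_m} P⟩`, where `D' = A - A P` (no
factor `1 / 2`) and `ε̂` are the oracle residuals. -/
def thetaHat (m : Fin M) (ω : Ω) : ℝ :=
  clusterFrob d.cluster m (d.A - d.A * d.P) (d.oracleResid ω) -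
    clusterFrob d.cluster m (d.A - d.A * d.P) (d.oracleResid ω * d.P)

variable [MeasurableSpace Ω]

/-- The errors have mean zero. -/
def MeanZero (μ : Measure Ω) : Prop :=
  ∀ i t, Integrable (fun ω => d.ε ω i t) μ ∧ ∫ ω, d.ε ω i t ∂μ = 0

/-- The submatrices `ε_{C_1}, …, ε_{C_M}` are jointly independent. -/
def ClusterIndep (μ : Measure Ω) : Prop :=
  iIndepFun (fun (m : Fin M) (ω : Ω) (p : {i : Fin d.N // d.cluster i = m} × Fin d.T) =>
    d.ε ω p.1 p.2) μ

end PanelModel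

/-- The Lyapunov condition on the cluster statistics of a triangular array, with uniformly bounded
moments of a higher order and variances bounded away from zero. -/
def Lyapunov {Ω : Type*} [MeasurableSpace Ω] (μ : Measure Ω) (d : ∀ M : ℕ, PanelModel Ω M) :
    Prop :=
  ∃ δ > (0 : ℝ), ∃ δ₁ > δ,
    Tendsto (fun M => (∑ m, ∫ ω, |(d M).thetaHat m ω| ^ (2 + δ) ∂μ) /
      √(∑ m, variance ((d M).thetaHat m) μ) ^ (2 + δ)) atTop (nhds 0) ∧
    (∃ b : ℝ, ∀ M m, Integrable (fun ω => |(d M).thetaHat m ω| ^ (2 + δ₁)) μ ∧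
      ∫ ω, |(d M).thetaHat m ω| ^ (2 + δ₁) ∂μ ≤ b) ∧
    ∃ v > 0, ∀ M m, v ≤ variance ((d M).thetaHat m) μ

end Mosaic

end

noncomputable section

namespace Mosaic

/-! ### Characteristic functions and the Lyapunov estimate -/

/-! Everything reduces to random signs. Since `P` is a symmetric involution, `D` is odd under `P`
(`D_mul_P`) and is orthogonal, cluster by cluster, to the augmented design. With ψ_m = ⟨D, ε⟩ and
w_m = ⟨D, D⟩ on cluster m, controls and residualization therefore drop out: β̂ - β = ∑ψ_m / ∑w_m,
and randomization multiplies the contribution of cluster m by s_m = (-1)^{B_m}.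

By `randomized_sub_eq`, the randomized statistic minus β - β̂ is then a positive multiple of ∑ψ_m -
∑s_mψ_m, except when all bits vanish. If β lies below the interval, the conditional probability over
the bits that ∑ψ_m ≤ ∑s_mψ_m is at most α/2 + 2^{-M}; if β lies above, the mirrored probability is.
It remains to show that this conditional rank is asymptotically no more concentrated near 0 than a
uniform variable (`eventually_measureReal_rank_le`), and to apply this to θ_m = 4ψ_m and to -θ_m.

Without invariance the rank is controlled only in the limit. For two independent sign vectors s, s',
the normalized triple (∑θ_m, ∑s_mθ_m, ∑s'_mθ_m) has identity covariance, because the signs are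
centered. It converges to a standard Gaussian on ℝ³ (`tendsto_charFun_jointLaw`). The second sign
vector turns the square of a conditional mean into an ordinary expectation, so weak convergence
shows that a smoothed rank is close in L² to a smoothed Gaussian tail at the normalized sum
(`integral_rampProd_jointLaw`). The Gaussian tail evaluated at a Gaussian variable is uniform;
`exists_measureReal_shift_lt` absorbs the smoothing. -/

lemma norm_prod_sub_prod_le {ι : Type*} (s : Finset ι) (a b : ι → ℂ)
    (ha : ∀ i ∈ s, ‖a i‖ ≤ 1) (hb : ∀ i ∈ s, ‖b i‖ ≤ 1) :
    ‖∏ i ∈ s, a i - ∏ i ∈ s, b i‖ ≤ ∑ i ∈ s, ‖a i - b i‖ := by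
  classical
  induction s using Finset.induction_on with
  | empty => simp
  | insert j s hj ih =>
    rw [Finset.prod_insert hj, Finset.prod_insert hj, Finset.sum_insert hj]
    have h1 := ih (fun i hi => ha i (Finset.mem_insert_of_mem hi))
      (fun i hi => hb i (Finset.mem_insert_of_mem hi))
    have h2 : ‖∏ i ∈ s, a i‖ ≤ 1 := by
      rw [norm_prod]
      exact Finset.prod_le_one (fun i _ => norm_nonneg _)
        (fun i hi => ha i (Finset.mem_insert_of_mem hi))
    have h3 := hb j (Finset.mem_insert_self j s)
    calc ‖a j * ∏ i ∈ s, a i - b j * ∏ i ∈ s, b i‖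
        = ‖(a j - b j) * ∏ i ∈ s, a i + b j * (∏ i ∈ s, a i - ∏ i ∈ s, b i)‖ := by ring_nf
      _ ≤ ‖a j - b j‖ * ‖∏ i ∈ s, a i‖ + ‖b j‖ * ‖∏ i ∈ s, a i - ∏ i ∈ s, b i‖ := by
          refine (norm_add_le _ _).trans ?_
          rw [norm_mul, norm_mul]
      _ ≤ _ := by
          gcongr
          · exact mul_le_of_le_one_right (norm_nonneg _) h2
          · exact (mul_le_of_le_one_left (norm_nonneg _) h3).trans h1

/-- For `q ≤ 1` the power `2 + q` lies between 2 and 3: it dominates the cubic remainder where `|x|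
≤ 1`, and the crude quadratic bound where `|x| ≥ 1`. -/
lemma norm_exp_mul_I_sub_taylor_le (x : ℝ) {q : ℝ} (hq : 0 < q) (hq1 : q ≤ 1) :
    ‖Complex.exp (x * Complex.I) - (1 + x * Complex.I - (x : ℂ) ^ 2 / 2)‖ ≤
      4 * |x| ^ (2 + q) := by
  have hn : ‖(x * Complex.I : ℂ)‖ = |x| := by simp
  rcases le_total |x| 1 with h | h
  · have := Complex.exp_bound (x := x * Complex.I) (by rw [hn]; exact h) (n := 3) (by norm_num)
    rw [hn] at this
    have e : ∑ m ∈ Finset.range 3, (x * Complex.I : ℂ) ^ m / m.factorial =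
        1 + x * Complex.I - (x : ℂ) ^ 2 / 2 := by
      simp [Finset.sum_range_succ, mul_pow]
      ring
    rw [e] at this
    have h3 : |x| ^ 3 ≤ |x| ^ (2 + q) := by
      rcases (abs_nonneg x).eq_or_lt with h0 | h0
      · rw [← h0, Real.zero_rpow (by linarith)]; norm_num
      · rw [← Real.rpow_natCast]
        exact Real.rpow_le_rpow_of_exponent_ge h0 h (by push_cast; linarith)
    have h4 : (0 : ℝ) ≤ |x| ^ 3 := by positivity
    norm_num [Nat.factorial] at this
    linarith
  · have h3 : |x| ^ 2 ≤ |x| ^ (2 + q) := by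
      rw [← Real.rpow_natCast]
      exact Real.rpow_le_rpow_of_exponent_le h (by push_cast; linarith)
    have h1 : ‖Complex.exp (x * Complex.I)‖ = 1 := Complex.norm_exp_ofReal_mul_I x
    have h2 : ‖(1 + x * Complex.I - (x : ℂ) ^ 2 / 2)‖ ≤ 1 + |x| + |x| ^ 2 / 2 := by
      refine (norm_sub_le _ _).trans ?_
      gcongr
      · refine (norm_add_le _ _).trans ?_
        simp
      · simp
    refine (norm_sub_le _ _).trans ?_
    nlinarith

lemma abs_exp_neg_sub_le {y : ℝ} (hy : 0 ≤ y) : |Real.exp (-y) - (1 - y)| ≤ y ^ 2 := by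
  have h1 := Real.add_one_le_exp (-y)
  rw [abs_of_nonneg (by linarith)]
  rcases le_total y 1 with h | h
  · have := Real.abs_exp_sub_one_sub_id_le (x := -y) (by rwa [abs_neg, abs_of_nonneg hy])
    have := le_abs_self (Real.exp (-y) - 1 - -y)
    nlinarith
  · have : Real.exp (-y) ≤ 1 := Real.exp_le_one_iff.2 (by linarith)
    nlinarith

/-! ### Second-order expansion of a centered characteristic function. -/

section Taylor

variable {Ω : Type*} [MeasurableSpace Ω] {μ : Measure Ω} [IsProbabilityMeasure μ]

lemma memLp_two_of_integrable_rpow {X : Ω → ℝ} (hX : Measurable X) {q : ℝ} (hq : 0 < q)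
    (hint : Integrable (fun ω => |X ω| ^ (2 + q)) μ) : MemLp X 2 μ := by
  rw [memLp_two_iff_integrable_sq hX.aestronglyMeasurable]
  refine ((integrable_const (1 : ℝ)).add hint).mono' (hX.pow_const 2).aestronglyMeasurable ?_
  refine .of_forall fun ω => ?_
  rw [Real.norm_eq_abs, abs_pow]
  simp only [Pi.add_apply]
  have h0 : 0 ≤ |X ω| ^ (2 + q) := by positivity
  rcases le_total |X ω| 1 with h | h
  · nlinarith [abs_nonneg (X ω)]
  · have : |X ω| ^ 2 ≤ |X ω| ^ (2 + q) := by
      rw [← Real.rpow_natCast]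
      exact Real.rpow_le_rpow_of_exponent_le h (by push_cast; linarith)
    linarith

lemma integral_sq_le {X : Ω → ℝ} (hX : Measurable X) {q : ℝ} (hq : 0 < q)
    (hint : Integrable (fun ω => |X ω| ^ (2 + q)) μ) :
    ∫ ω, X ω ^ 2 ∂μ ≤ 1 + ∫ ω, |X ω| ^ (2 + q) ∂μ := by
  have : ∫ ω, (1 + |X ω| ^ (2 + q)) ∂μ = 1 + ∫ ω, |X ω| ^ (2 + q) ∂μ := by
    rw [integral_add (integrable_const _) hint]; simp
  rw [← this]
  refine integral_mono (memLp_two_of_integrable_rpow hX hq hint).integrable_sq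
    ((integrable_const _).add hint) fun ω => ?_
  have h0 : 0 ≤ |X ω| ^ (2 + q) := by positivity
  rw [← sq_abs]
  rcases le_total |X ω| 1 with h | h
  · nlinarith [abs_nonneg (X ω)]
  · have : |X ω| ^ 2 ≤ |X ω| ^ (2 + q) := by
      rw [← Real.rpow_natCast]
      exact Real.rpow_le_rpow_of_exponent_le h (by push_cast; linarith)
    linarith

lemma norm_charFun_sub_taylor_le {X : Ω → ℝ} (hX : Measurable X) {q : ℝ} (hq : 0 < q)
    (hq1 : q ≤ 1) (hint : Integrable (fun ω => |X ω| ^ (2 + q)) μ) (h0 : ∫ ω, X ω ∂μ = 0)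
    (t : ℝ) :
    ‖charFun (μ.map X) t - ((1 - t ^ 2 * (∫ ω, X ω ^ 2 ∂μ) / 2 : ℝ) : ℂ)‖ ≤
      4 * |t| ^ (2 + q) * ∫ ω, |X ω| ^ (2 + q) ∂μ := by
  have h2 := memLp_two_of_integrable_rpow hX hq hint
  have hX1 : Integrable X μ := h2.integrable (by norm_num)
  have hX2 : Integrable (fun ω => X ω ^ 2) μ := h2.integrable_sq
  have i1 : Integrable (fun ω => (1 : ℂ) + ((t * X ω : ℝ) : ℂ) * Complex.I) μ :=
    (integrable_const _).add ((hX1.const_mul t).ofReal.mul_const _)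
  have i2 : Integrable (fun ω => (((t * X ω : ℝ) : ℂ)) ^ 2 / 2) μ := by
    have : Integrable (fun ω => ((t ^ 2 * X ω ^ 2 / 2 : ℝ) : ℂ)) μ :=
      ((hX2.const_mul (t ^ 2)).div_const 2).ofReal
    refine this.congr (.of_forall fun ω => ?_)
    push_cast; ring
  have i3 : Integrable (fun ω => Complex.exp (((t * X ω : ℝ) : ℂ) * Complex.I)) μ := by
    refine (integrable_const (1 : ℝ)).mono' (by fun_prop) (.of_forall fun ω => ?_)
    rw [Complex.norm_exp_ofReal_mul_I]
  have e1 : charFun (μ.map X) t =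
      ∫ ω, Complex.exp (((t * X ω : ℝ) : ℂ) * Complex.I) ∂μ := by
    rw [charFun_apply_real, integral_map hX.aemeasurable (by fun_prop)]
    simp
  have e2 : ((1 - t ^ 2 * (∫ ω, X ω ^ 2 ∂μ) / 2 : ℝ) : ℂ) =
      ∫ ω, (1 + ((t * X ω : ℝ) : ℂ) * Complex.I - (((t * X ω : ℝ) : ℂ)) ^ 2 / 2) ∂μ := by
    rw [integral_sub i1 i2, integral_add (integrable_const _)
      ((hX1.const_mul t).ofReal.mul_const _), integral_mul_const, integral_div]
    have a1 : ∫ ω, ((t * X ω : ℝ) : ℂ) ∂μ = 0 := by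
      rw [integral_complex_ofReal, integral_const_mul, h0]; simp
    have a2 : ∫ ω, (((t * X ω : ℝ) : ℂ)) ^ 2 ∂μ = ((t ^ 2 * ∫ ω, X ω ^ 2 ∂μ : ℝ) : ℂ) := by
      rw [← integral_const_mul, ← integral_complex_ofReal]
      congr 1; ext ω; push_cast; ring
    rw [a1, a2]
    simp
  have i4 : Integrable (fun ω => 1 + ((t * X ω : ℝ) : ℂ) * Complex.I -
      (((t * X ω : ℝ) : ℂ)) ^ 2 / 2) μ := i1.sub i2
  rw [e1, e2, ← integral_sub i3 i4, ← integral_const_mul]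
  refine norm_integral_le_of_norm_le (hint.const_mul _) (.of_forall fun ω => ?_)
  refine (norm_exp_mul_I_sub_taylor_le (t * X ω) hq hq1).trans_eq ?_
  rw [abs_mul, Real.mul_rpow (abs_nonneg _) (abs_nonneg _)]
  ring

end Taylor

/-! ### Random signs -/

/-- The sign `(-1) ^ b`. -/
def bitSign (b : Bool) : ℝ := if b then -1 else 1

instance {M : ℕ} : IsProbabilityMeasure (bitLaw M) := by
  unfold bitLaw; infer_instance

lemma integral_bitLaw_prod {M : ℕ} (f : Fin M → Bool → ℂ) :
    ∫ B, ∏ m, f m (B m) ∂(bitLaw M) = ∏ m, (f m true + f m false) / 2 := by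
  rw [bitLaw, integral_fintype_prod_eq_prod]
  refine Finset.prod_congr rfl fun m _ => ?_
  rw [integral_bernoulliMeasure]
  simp
  ring

lemma integral_bitLaw_bitLaw_prod {M : ℕ} (f : Fin M → Bool → Bool → ℂ) :
    ∫ B, ∫ B', ∏ m, f m (B m) (B' m) ∂(bitLaw M) ∂(bitLaw M) =
      ∏ m, (f m true true + f m true false + f m false true + f m false false) / 4 := by
  simp_rw [fun B : Fin M → Bool => integral_bitLaw_prod (fun m b' => f m (B m) b')]
  rw [integral_bitLaw_prod (fun m b => (f m b true + f m b false) / 2)]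
  refine Finset.prod_congr rfl fun m _ => ?_
  ring

/-! ### A central limit theorem for sums with random signs -/

/-- Three-dimensional Euclidean space as an iterated product. -/
abbrev Space3 : Type := WithLp 2 (ℝ × WithLp 2 (ℝ × ℝ))

/-- The standard Gaussian law on the line. -/
abbrev gauss : Measure ℝ := gaussianReal 0 1

/-- The standard Gaussian law on `Space3`. -/
def gauss3 : Measure Space3 :=
  (gauss.prod ((gauss.prod gauss).map (WithLp.toLp 2))).map (WithLp.toLp 2)

instance : IsProbabilityMeasure gauss3 := by
  have : IsProbabilityMeasure ((gauss.prod gauss).map (WithLp.toLp 2)) :=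
    Measure.isProbabilityMeasure_map (by fun_prop)
  exact Measure.isProbabilityMeasure_map (by fun_prop)

lemma charFun_gauss3 (t : Space3) :
    charFun gauss3 t =
      ((Real.exp (-((t.fst ^ 2 + t.snd.fst ^ 2 + t.snd.snd ^ 2) / 2)) : ℝ) : ℂ) := by
  have : IsProbabilityMeasure ((gauss.prod gauss).map (WithLp.toLp 2)) :=
    Measure.isProbabilityMeasure_map (by fun_prop)
  rw [gauss3, charFun_prod, charFun_prod, charFun_gaussianReal, charFun_gaussianReal,
    charFun_gaussianReal, ← Complex.exp_add, ← Complex.exp_add, Complex.ofReal_exp]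
  congr 1
  push_cast
  simp
  ring

/-- The sum of the `x m` with signs `(-1) ^ B m`. -/
def signSum {M : ℕ} (x : Fin M → ℝ) (B : Fin M → Bool) : ℝ := ∑ m, bitSign (B m) * x m

/-- A sum and two signed sums, with a common scaling. -/
def jointVec {M : ℕ} (r : ℝ) (x : Fin M → ℝ) (B B' : Fin M → Bool) : Space3 :=
  WithLp.toLp 2 (r * ∑ m, x m, WithLp.toLp 2 (r * signSum x B, r * signSum x B'))

/-- The coefficient of a summand in the characteristic function of `jointVec`. -/
def signCoef (t : Space3) (b b' : Bool) : ℝ :=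
  t.fst + bitSign b * t.snd.fst + bitSign b' * t.snd.snd

lemma inner_jointVec {M : ℕ} (r : ℝ) (x : Fin M → ℝ) (B B' : Fin M → Bool) (t : Space3) :
    inner ℝ (jointVec r x B B') t = ∑ m, r * signCoef t (B m) (B' m) * x m := by
  simp only [jointVec, WithLp.prod_inner_apply, signSum, signCoef]
  simp only [Real.inner_apply, Finset.mul_sum, Finset.sum_mul, ← Finset.sum_add_distrib]
  refine Finset.sum_congr rfl fun m _ => ?_
  simp only [WithLp.fst, WithLp.snd]
  ring

lemma abs_signCoef_le (t : Space3) (b b' : Bool) :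
    |signCoef t b b'| ≤ |t.fst| + |t.snd.fst| + |t.snd.snd| := by
  refine (abs_add_le _ _).trans (add_le_add ((abs_add_le _ _).trans (add_le_add le_rfl ?_)) ?_) <;>
  · rw [abs_mul]
    refine mul_le_of_le_one_left (abs_nonneg _) ?_
    unfold bitSign; split_ifs <;> simp

section CLT

variable {Ω : Type*} [MeasurableSpace Ω] {μ : Measure Ω} [IsProbabilityMeasure μ]

/-- Averaging `signCoef ^ 2` over the four sign pairs kills the cross terms and leaves the squared
norm of `t`. This is why the limiting covariance is the identity, although the three sums share the
same summands. -/
lemma norm_avg_charFun_sub_le {X : Ω → ℝ} (hX : Measurable X) {q K : ℝ} (hq : 0 < q)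
    (hq1 : q ≤ 1) (hint : Integrable (fun ω => |X ω| ^ (2 + q)) μ)
    (hK : ∫ ω, |X ω| ^ (2 + q) ∂μ ≤ K) (h0 : ∫ ω, X ω ∂μ = 0) {r : ℝ} (hr : 0 ≤ r)
    (t : Space3) :
    ‖(charFun (μ.map X) (r * signCoef t true true) + charFun (μ.map X) (r * signCoef t true false) +
      charFun (μ.map X) (r * signCoef t false true) +
      charFun (μ.map X) (r * signCoef t false false)) / 4 -
      ((Real.exp (-((t.fst ^ 2 + t.snd.fst ^ 2 + t.snd.snd ^ 2) / 2 *
        (r ^ 2 * ∫ ω, X ω ^ 2 ∂μ))) : ℝ) : ℂ)‖ ≤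
    4 * (r * (|t.fst| + |t.snd.fst| + |t.snd.snd|)) ^ (2 + q) * K +
      ((t.fst ^ 2 + t.snd.fst ^ 2 + t.snd.snd ^ 2) / 2 * (r ^ 2 * (1 + K))) ^ 2 := by
  set V := ∫ ω, X ω ^ 2 ∂μ with hV
  set L := |t.fst| + |t.snd.fst| + |t.snd.snd| with hL
  set n := (t.fst ^ 2 + t.snd.fst ^ 2 + t.snd.snd ^ 2) / 2 with hn
  have hn0 : 0 ≤ n := by positivity
  have hV0 : 0 ≤ V := integral_nonneg fun ω => sq_nonneg _
  have hV1 : V ≤ 1 + K := (integral_sq_le hX hq hint).trans (by linarith)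
  have hK0 : 0 ≤ K := le_trans (integral_nonneg fun ω => by positivity) hK
  have key (b b' : Bool) : ‖charFun (μ.map X) (r * signCoef t b b') -
      ((1 - (r * signCoef t b b') ^ 2 * V / 2 : ℝ) : ℂ)‖ ≤ 4 * (r * L) ^ (2 + q) * K := by
    refine (norm_charFun_sub_taylor_le hX hq hq1 hint h0 _).trans ?_
    have : |r * signCoef t b b'| ≤ r * L := by
      rw [abs_mul, abs_of_nonneg hr]
      exact mul_le_mul_of_nonneg_left (abs_signCoef_le t b b') hr
    gcongr
  have e : (charFun (μ.map X) (r * signCoef t true true) +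
      charFun (μ.map X) (r * signCoef t true false) +
      charFun (μ.map X) (r * signCoef t false true) +
      charFun (μ.map X) (r * signCoef t false false)) / 4 -
      ((Real.exp (-(n * (r ^ 2 * V))) : ℝ) : ℂ) =
    ((charFun (μ.map X) (r * signCoef t true true) -
        ((1 - (r * signCoef t true true) ^ 2 * V / 2 : ℝ) : ℂ)) +
      (charFun (μ.map X) (r * signCoef t true false) -
        ((1 - (r * signCoef t true false) ^ 2 * V / 2 : ℝ) : ℂ)) +
      (charFun (μ.map X) (r * signCoef t false true) -
        ((1 - (r * signCoef t false true) ^ 2 * V / 2 : ℝ) : ℂ)) +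
      (charFun (μ.map X) (r * signCoef t false false) -
        ((1 - (r * signCoef t false false) ^ 2 * V / 2 : ℝ) : ℂ))) / 4 -
      ((Real.exp (-(n * (r ^ 2 * V))) - (1 - n * (r ^ 2 * V)) : ℝ) : ℂ) := by
    simp only [hn, signCoef, bitSign]
    push_cast
    simp
    ring
  rw [e]
  have hexp : ‖((Real.exp (-(n * (r ^ 2 * V))) - (1 - n * (r ^ 2 * V)) : ℝ) : ℂ)‖ ≤
      (n * (r ^ 2 * (1 + K))) ^ 2 := by
    rw [Complex.norm_real, Real.norm_eq_abs]
    refine (abs_exp_neg_sub_le (by positivity)).trans ?_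
    gcongr
  refine (norm_sub_le _ _).trans (add_le_add ?_ hexp)
  rw [norm_div]
  have := (norm_add_le _ _).trans (add_le_add ((norm_add_le _ _).trans (add_le_add
    ((norm_add_le _ _).trans (add_le_add (key true true) (key true false)))
      (key false true))) (key false false))
  simp only [Complex.norm_ofNat]
  linarith

/-- A triangular array of independent centered variables with uniformly bounded moments of order
`2 + q` and variances bounded below. -/
structure CenteredArray (μ : Measure Ω) (θ : ∀ M : ℕ, Fin M → Ω → ℝ) (q K v : ℝ) : Prop where
  measurable : ∀ M m, Measurable (θ M m)
  indep : ∀ M, iIndepFun (θ M) μ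
  mean : ∀ M m, ∫ ω, θ M m ω ∂μ = 0
  q_pos : 0 < q
  q_le : q ≤ 1
  integrable : ∀ M m, Integrable (fun ω => |θ M m ω| ^ (2 + q)) μ
  moment_le : ∀ M m, ∫ ω, |θ M m ω| ^ (2 + q) ∂μ ≤ K
  v_pos : 0 < v
  le_var : ∀ M m, v ≤ ∫ ω, θ M m ω ^ 2 ∂μ

/-- The sum of the second moments. -/
def totalVar (μ : Measure Ω) {M : ℕ} (x : Fin M → Ω → ℝ) : ℝ := ∑ m, ∫ ω, x m ω ^ 2 ∂μ

/-- The joint law of the normalized sum and of two normalized signed sums with independent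
signs. -/
def jointLaw (μ : Measure Ω) {M : ℕ} (x : Fin M → Ω → ℝ) : Measure Space3 :=
  (μ.prod ((bitLaw M).prod (bitLaw M))).map fun p =>
    jointVec (√(totalVar μ x))⁻¹ (fun m => x m p.1) p.2.1 p.2.2

lemma measurable_signSum {M : ℕ} {x : Fin M → Ω → ℝ} (hx : ∀ m, Measurable (x m)) :
    Measurable fun p : Ω × (Fin M → Bool) => signSum (fun m => x m p.1) p.2 := by
  unfold signSum
  refine Finset.measurable_sum _ fun m _ => ?_
  refine Measurable.mul ?_ ((hx m).comp measurable_fst)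
  exact (measurable_of_countable bitSign).comp ((measurable_pi_apply m).comp measurable_snd)

lemma measurable_jointVec {M : ℕ} {x : Fin M → Ω → ℝ} (hx : ∀ m, Measurable (x m)) (r : ℝ) :
    Measurable fun p : Ω × ((Fin M → Bool) × (Fin M → Bool)) =>
      jointVec r (fun m => x m p.1) p.2.1 p.2.2 := by
  have h1 : Measurable fun p : Ω × ((Fin M → Bool) × (Fin M → Bool)) =>
      signSum (fun m => x m p.1) p.2.1 :=
    (measurable_signSum hx).comp (measurable_fst.prodMk (measurable_fst.comp measurable_snd))
  have h2 : Measurable fun p : Ω × ((Fin M → Bool) × (Fin M → Bool)) =>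
      signSum (fun m => x m p.1) p.2.2 :=
    (measurable_signSum hx).comp (measurable_fst.prodMk (measurable_snd.comp measurable_snd))
  have h3 : Measurable fun p : Ω × ((Fin M → Bool) × (Fin M → Bool)) => ∑ m, x m p.1 :=
    Finset.measurable_sum _ fun m _ => (hx m).comp measurable_fst
  unfold jointVec
  fun_prop

lemma isProbabilityMeasure_jointLaw {M : ℕ} {x : Fin M → Ω → ℝ} (hx : ∀ m, Measurable (x m)) :
    IsProbabilityMeasure (jointLaw μ x) :=
  Measure.isProbabilityMeasure_map (measurable_jointVec hx _).aemeasurable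

omit [IsProbabilityMeasure μ] in
lemma integral_exp_sum_eq {M : ℕ} {x : Fin M → Ω → ℝ} (hx : ∀ m, Measurable (x m))
    (hi : iIndepFun x μ) (a : Fin M → ℝ) :
    ∫ ω, Complex.exp (((∑ m, a m * x m ω : ℝ) : ℂ) * Complex.I) ∂μ =
      ∏ m, charFun (μ.map (x m)) (a m) := by
  have hi' : iIndepFun (fun m ω => a m * x m ω) μ :=
    hi.comp (fun m y => a m * y) fun m => measurable_const_mul _
  have hm (m : Fin M) : AEMeasurable (fun ω => a m * x m ω) μ :=
    ((hx m).const_mul _).aemeasurable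
  have h := congrFun (hi'.charFun_map_fun_sum_eq_prod hm) 1
  rw [Finset.prod_apply, charFun_apply_real,
    integral_map (Finset.aemeasurable_fun_sum _ fun m _ => hm m) (by fun_prop)] at h
  simp only [Complex.ofReal_one, one_mul] at h
  rw [h]
  refine Finset.prod_congr rfl fun m _ => ?_
  rw [charFun_map_mul_comp (hx m).aemeasurable, mul_one]

/-- By Fubini the data are integrated first, with the signs frozen; independence across clusters
gives a product, whose factors are then averaged separately over their own pair of bits. -/
lemma charFun_jointLaw {M : ℕ} {x : Fin M → Ω → ℝ} (hx : ∀ m, Measurable (x m))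
    (hi : iIndepFun x μ) (t : Space3) :
    charFun (jointLaw μ x) t = ∏ m,
      (charFun (μ.map (x m)) ((√(totalVar μ x))⁻¹ * signCoef t true true) +
      charFun (μ.map (x m)) ((√(totalVar μ x))⁻¹ * signCoef t true false) +
      charFun (μ.map (x m)) ((√(totalVar μ x))⁻¹ * signCoef t false true) +
      charFun (μ.map (x m)) ((√(totalVar μ x))⁻¹ * signCoef t false false)) / 4 := by
  set r := (√(totalVar μ x))⁻¹
  have hmeas := measurable_jointVec hx r
  have hint : Integrable (fun p : Ω × ((Fin M → Bool) × (Fin M → Bool)) =>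
      Complex.exp ((inner ℝ (jointVec r (fun m => x m p.1) p.2.1 p.2.2) t : ℝ) * Complex.I))
      (μ.prod ((bitLaw M).prod (bitLaw M))) := by
    refine (integrable_const (1 : ℝ)).mono' ?_ (.of_forall fun p => ?_)
    · have : Measurable fun p : Ω × ((Fin M → Bool) × (Fin M → Bool)) =>
        inner ℝ (jointVec r (fun m => x m p.1) p.2.1 p.2.2) t := hmeas.inner_const
      exact (Complex.measurable_exp.comp
        ((Complex.measurable_ofReal.comp this).mul_const _)).aestronglyMeasurable
    · rw [Complex.norm_exp_ofReal_mul_I]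
  rw [charFun_apply, jointLaw, integral_map hmeas.aemeasurable (by fun_prop),
    integral_prod_symm _ hint]
  rw [← integral_bitLaw_bitLaw_prod
    (fun m b b' => charFun (μ.map (x m)) (r * signCoef t b b')), integral_prod]
  · simp_rw [inner_jointVec, integral_exp_sum_eq hx hi]
  · exact hint.integral_prod_right

lemma norm_charFun_jointLaw_sub_le {θ : ∀ M : ℕ, Fin M → Ω → ℝ} {q K v : ℝ}
    (h : CenteredArray μ θ q K v) {M : ℕ} (hM : 0 < M) (t : Space3) :
    ‖charFun (jointLaw μ (θ M)) t - charFun gauss3 t‖ ≤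
      M * (4 * ((√(totalVar μ (θ M)))⁻¹ * (|t.fst| + |t.snd.fst| + |t.snd.snd|)) ^ (2 + q) * K +
      ((t.fst ^ 2 + t.snd.fst ^ 2 + t.snd.snd ^ 2) / 2 *
        ((√(totalVar μ (θ M)))⁻¹ ^ 2 * (1 + K))) ^ 2) := by
  have hpos : 0 < totalVar μ (θ M) := by
    have : NeZero M := ⟨hM.ne'⟩
    exact Finset.sum_pos (fun m _ => h.v_pos.trans_le (h.le_var M m)) Finset.univ_nonempty
  -- The normalization makes the scaled variances sum to 1, so the Gaussian limit factors over the
  -- clusters and can be compared factor by factor.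
  have e : charFun gauss3 t = ∏ m, ((Real.exp
      (-((t.fst ^ 2 + t.snd.fst ^ 2 + t.snd.snd ^ 2) / 2 *
        ((√(totalVar μ (θ M)))⁻¹ ^ 2 * ∫ ω, θ M m ω ^ 2 ∂μ))) : ℝ) : ℂ) := by
    rw [charFun_gauss3, ← Complex.ofReal_prod, ← Real.exp_sum, Finset.sum_neg_distrib,
      ← Finset.mul_sum, ← Finset.mul_sum]
    congr 4
    rw [← totalVar, inv_pow, Real.sq_sqrt hpos.le, inv_mul_cancel₀ hpos.ne', mul_one]
  rw [e, charFun_jointLaw (h.measurable M) (h.indep M)]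
  refine (norm_prod_sub_prod_le _ _ _ ?_ ?_).trans ?_
  · intro m _
    have : IsProbabilityMeasure (μ.map (θ M m)) :=
      Measure.isProbabilityMeasure_map (h.measurable M m).aemeasurable
    have hc (s : ℝ) : ‖charFun (μ.map (θ M m)) s‖ ≤ 1 := norm_charFun_le_one s
    rw [norm_div]
    have := (norm_add_le _ _).trans (add_le_add ((norm_add_le _ _).trans (add_le_add
      ((norm_add_le _ _).trans (add_le_add
      (hc ((√(totalVar μ (θ M)))⁻¹ * signCoef t true true))
      (hc ((√(totalVar μ (θ M)))⁻¹ * signCoef t true false))))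
      (hc ((√(totalVar μ (θ M)))⁻¹ * signCoef t false true))))
      (hc ((√(totalVar μ (θ M)))⁻¹ * signCoef t false false)))
    simp only [Complex.norm_ofNat]
    linarith
  · intro m _
    rw [Complex.norm_real, Real.norm_eq_abs, abs_of_pos (Real.exp_pos _), Real.exp_le_one_iff]
    have : 0 ≤ ∫ ω, θ M m ω ^ 2 ∂μ := integral_nonneg fun _ => sq_nonneg _
    simp only [neg_nonpos]
    positivity
  · refine (Finset.sum_le_card_nsmul _ _ _ fun m _ => norm_avg_charFun_sub_le (h.measurable M m)
      h.q_pos h.q_le (h.integrable M m) (h.moment_le M m) (h.mean M m) (by positivity) t).trans_eq ?_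
    rw [Finset.card_univ, Fintype.card_fin, nsmul_eq_mul]

/-- The lower bound `v` on the variances makes the squared scaling at most 1/(vM). The M summands
thus contribute orders M · M^{-(1+q/2)} and M · M^{-2}, both vanishing. -/
lemma tendsto_charFun_jointLaw {θ : ∀ M : ℕ, Fin M → Ω → ℝ} {q K v : ℝ}
    (h : CenteredArray μ θ q K v) (t : Space3) :
    Tendsto (fun M => charFun (jointLaw μ (θ M)) t) atTop (nhds (charFun gauss3 t)) := by
  set L := |t.fst| + |t.snd.fst| + |t.snd.snd|
  set n := (t.fst ^ 2 + t.snd.fst ^ 2 + t.snd.snd ^ 2) / 2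
  have hL : 0 ≤ L := by positivity
  have hn : 0 ≤ n := by positivity
  have hq := h.q_pos
  have hv := h.v_pos
  have hK : 0 ≤ K := le_trans (integral_nonneg fun ω => by positivity) (h.moment_le 1 0)
  rw [tendsto_iff_norm_sub_tendsto_zero]
  have lim : Tendsto (fun M : ℕ => 4 * (L ^ (2 + q) * v ^ (-(1 + q / 2))) * K *
      (M : ℝ) ^ (-(q / 2)) + (n * (v⁻¹ * (1 + K))) ^ 2 * ((M : ℝ))⁻¹) atTop (nhds 0) := by
    have l1 : Tendsto (fun M : ℕ => (M : ℝ) ^ (-(q / 2))) atTop (nhds 0) :=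
      (tendsto_rpow_neg_atTop (by linarith)).comp tendsto_natCast_atTop_atTop
    have l2 : Tendsto (fun M : ℕ => ((M : ℝ))⁻¹) atTop (nhds 0) := tendsto_inv_atTop_nhds_zero_nat
    simpa using (l1.const_mul _).add (l2.const_mul _)
  refine squeeze_zero' (.of_forall fun _ => norm_nonneg _) ?_ lim
  filter_upwards [eventually_gt_atTop 0] with M hM
  have hM' : (0 : ℝ) < M := by exact_mod_cast hM
  refine (norm_charFun_jointLaw_sub_le h hM t).trans ?_
  have hS : v * M ≤ totalVar μ (θ M) := by
    have := Finset.card_nsmul_le_sum Finset.univ (fun m => ∫ ω, θ M m ω ^ 2 ∂μ) v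
      fun m _ => h.le_var M m
    simpa [totalVar, mul_comm] using this
  have hvM : 0 < v * M := by positivity
  have hr2 : (√(totalVar μ (θ M)))⁻¹ ^ 2 ≤ v⁻¹ * (M : ℝ)⁻¹ := by
    rw [inv_pow, Real.sq_sqrt (hvM.le.trans hS), ← mul_inv]
    exact inv_anti₀ hvM hS
  have hr3 : (√(totalVar μ (θ M)))⁻¹ ^ (2 + q) ≤
      v ^ (-(1 + q / 2)) * (M : ℝ) ^ (-(1 + q / 2)) := by
    have e : (√(totalVar μ (θ M)))⁻¹ ^ (2 + q) =
        ((√(totalVar μ (θ M)))⁻¹ ^ 2) ^ (1 + q / 2) := by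
      rw [← Real.rpow_natCast, ← Real.rpow_mul (by positivity)]
      congr 1; push_cast; ring
    rw [e]
    refine (Real.rpow_le_rpow (by positivity) hr2 (by linarith)).trans_eq ?_
    rw [Real.mul_rpow (by positivity) (by positivity), Real.inv_rpow hv.le, Real.inv_rpow hM'.le,
      Real.rpow_neg hv.le, Real.rpow_neg hM'.le]
  rw [Real.mul_rpow (by positivity) hL]
  have e1 : (M : ℝ) ^ (-(q / 2)) = M * (M : ℝ) ^ (-(1 + q / 2)) := by
    rw [show -(q / 2) = 1 + -(1 + q / 2) by ring, Real.rpow_add hM', Real.rpow_one]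
  calc _ ≤ (M : ℝ) * (4 * (v ^ (-(1 + q / 2)) * (M : ℝ) ^ (-(1 + q / 2)) * L ^ (2 + q)) * K +
        (n * ((v⁻¹ * (M : ℝ)⁻¹) * (1 + K))) ^ 2) := by gcongr
    _ = _ := by
      rw [e1]
      field_simp

end CLT

/-! ### The conditional rank of the sum among its signed versions -/

/-- A tail probability evaluated at its own variable is stochastically at least uniform, atoms or
not. A compact subset of the event has a least element `x`, hence lies in `Set.Ici x`, whose mass is
at most `a`; inner regularity concludes. -/
lemma measure_setOf_Ici_le_le (ν : Measure ℝ) [IsProbabilityMeasure ν] {a : ℝ} (ha : 0 ≤ a) :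
    ν.real {x | ν.real (Set.Ici x) ≤ a} ≤ a := by
  have hanti : Antitone fun x => ν.real (Set.Ici x) :=
    fun x y hxy => measureReal_mono (Set.Ici_subset_Ici.2 hxy)
  have hmeas : MeasurableSet {x | ν.real (Set.Ici x) ≤ a} :=
    measurableSet_le hanti.measurable measurable_const
  rw [measureReal_def]
  refine ENNReal.toReal_le_of_le_ofReal ha ?_
  rw [hmeas.measure_eq_iSup_isCompact]
  refine iSup₂_le fun k hk => iSup_le fun hc => ?_
  rcases k.eq_empty_or_nonempty with rfl | hne
  · simp
  obtain ⟨x, hx, hxk⟩ := hc.exists_isLeast hne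
  refine (measure_mono (show k ⊆ Set.Ici x from fun y hy => hxk hy)).trans ?_
  have : ν.real (Set.Ici x) ≤ a := hk hx
  rw [measureReal_def] at this
  exact (ENNReal.le_ofReal_iff_toReal_le (measure_ne_top _ _) ha).2 this

lemma exists_measureReal_shift_lt (ν : Measure ℝ) [IsProbabilityMeasure ν] [NullSingletonClass ν] {a ε : ℝ}
    (ha : 0 ≤ a) (hε : 0 < ε) :
    ∃ κ > 0, ν.real {x | ν.real (Set.Ici (x + κ)) ≤ a + 2 * κ} < a + ε := by
  let k : ℕ → ℝ := fun n => 1 / ((n : ℝ) + 1)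
  have hk0 (n) : 0 < k n := by positivity
  have hk : Antitone k := fun m n h => one_div_le_one_div_of_le (by positivity) (by gcongr)
  have hklim : Tendsto k atTop (nhds 0) := tendsto_one_div_add_atTop_nhds_zero_nat
  have hanti : Antitone fun x => ν.real (Set.Ici x) :=
    fun x y hxy => measureReal_mono (Set.Ici_subset_Ici.2 hxy)
  let S : ℕ → Set ℝ := fun n => {x | ν.real (Set.Ici (x + k n)) ≤ a + 2 * k n}
  have hS : Antitone S := by
    intro m n h x hx
    have h2 := hanti (add_le_add_right (hk h) x)
    have h3 : ν.real (Set.Ici (x + k n)) ≤ a + 2 * k n := hx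
    have h4 := hk h
    change ν.real (Set.Ici (x + k m)) ≤ a + 2 * k m
    simp only at h2
    linarith
  have hSm (n) : MeasurableSet (S n) := measurableSet_le
    (hanti.measurable.comp (measurable_id.add_const (k n))) measurable_const
  have hlim := tendsto_measure_iInter_atTop (μ := ν) (fun n => (hSm n).nullMeasurableSet) hS
    ⟨0, measure_ne_top _ _⟩
  have hsub : ⋂ n, S n ⊆ {x | ν.real (Set.Ici x) ≤ a} := by
    intro x hx
    have hx' (n) : ν.real (Set.Ici (x + k n)) ≤ a + 2 * k n := Set.mem_iInter.1 hx n
    -- The shifted tails increase only to the open half-line; the absence of atoms restores the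
    -- closed one.
    have hU : Set.Ioi x = ⋃ n, Set.Ici (x + k n) := by
      ext y
      simp only [Set.mem_Ioi, Set.mem_iUnion, Set.mem_Ici]
      constructor
      · intro hy
        obtain ⟨n, hn⟩ := exists_nat_one_div_lt (sub_pos.2 hy)
        exact ⟨n, by simp only [k]; linarith⟩
      · rintro ⟨n, hn⟩
        linarith [hk0 n]
    have hmono : Monotone fun n => Set.Ici (x + k n) :=
      fun m n h => Set.Ici_subset_Ici.2 (add_le_add_right (hk h) x)
    have h1 := tendsto_measure_iUnion_atTop (μ := ν) hmono
    rw [← hU, Ioi_ae_eq_Ici.measure_eq] at h1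
    have h2 := (ENNReal.tendsto_toReal (measure_ne_top ν _)).comp h1
    have h3 : Tendsto (fun n => a + 2 * k n) atTop (nhds a) := by
      simpa using (hklim.const_mul 2).const_add a
    exact le_of_tendsto_of_tendsto' h2 h3 hx'
  have h4 : (ν (⋂ n, S n)).toReal < a + ε := by
    have := measureReal_mono (μ := ν) hsub
    have := measure_setOf_Ici_le_le ν ha
    simp only [measureReal_def] at *
    linarith
  have h5 := (ENNReal.tendsto_toReal (measure_ne_top ν _)).comp hlim
  obtain ⟨n, hn⟩ := (h5.eventually_lt_const h4).exists
  exact ⟨k n, hk0 n, hn⟩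

/-- The piecewise linear function that rises from `0` to `1` on `[0, κ]`. -/
def ramp (κ x : ℝ) : ℝ := max 0 (min 1 (x / κ))

lemma continuous_ramp (κ : ℝ) : Continuous (ramp κ) := by unfold ramp; fun_prop

lemma ramp_nonneg (κ x : ℝ) : 0 ≤ ramp κ x := le_max_left _ _

lemma ramp_le_one (κ x : ℝ) : ramp κ x ≤ 1 := max_le zero_le_one (min_le_left _ _)

lemma ramp_of_nonpos {κ x : ℝ} (hκ : 0 < κ) (hx : x ≤ 0) : ramp κ x = 0 :=
  max_eq_left ((min_le_right _ _).trans (div_nonpos_of_nonpos_of_nonneg hx hκ.le))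

lemma ramp_of_le {κ x : ℝ} (hκ : 0 < κ) (hx : κ ≤ x) : ramp κ x = 1 := by
  rw [ramp, min_eq_left ((one_le_div hκ).2 hx), max_eq_right zero_le_one]

lemma integrable_ramp {α : Type*} [MeasurableSpace α] (ν : Measure α) [IsFiniteMeasure ν]
    (κ : ℝ) {f : α → ℝ} (hf : Measurable f) : Integrable (fun x => ramp κ (f x)) ν := by
  refine (integrable_const (1 : ℝ)).mono'
    ((continuous_ramp κ).measurable.comp hf).aestronglyMeasurable (.of_forall fun x => ?_)
  rw [Real.norm_eq_abs, abs_of_nonneg (ramp_nonneg _ _)]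
  exact ramp_le_one _ _

/-- The Gaussian average of the ramp started at `x`. -/
def rampTail (κ x : ℝ) : ℝ := ∫ z, ramp κ (z - x) ∂gauss

lemma continuous_rampTail (κ : ℝ) : Continuous (rampTail κ) := by
  have hc := continuous_ramp κ
  refine continuous_of_dominated (bound := fun _ => 1) (fun x => ?_) (fun x => ?_)
    (integrable_const _) (.of_forall fun z => ?_)
  · exact (hc.comp (continuous_id.sub continuous_const)).aestronglyMeasurable
  · refine .of_forall fun z => ?_
    rw [Real.norm_eq_abs, abs_of_nonneg (ramp_nonneg _ _)]
    exact ramp_le_one _ _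
  · exact hc.comp (continuous_const.sub continuous_id)

lemma rampTail_nonneg (κ x : ℝ) : 0 ≤ rampTail κ x :=
  integral_nonneg fun _ => ramp_nonneg _ _

lemma rampTail_le_one (κ x : ℝ) : rampTail κ x ≤ 1 := by
  have := integral_mono (integrable_ramp gauss κ (measurable_id.sub_const x))
    (integrable_const (1 : ℝ)) fun z => ramp_le_one κ (z - x)
  simpa [rampTail] using this

lemma measureReal_Ici_le_rampTail {κ : ℝ} (hκ : 0 < κ) (x : ℝ) :
    gauss.real (Set.Ici (x + κ)) ≤ rampTail κ x := by
  rw [← integral_indicator_one measurableSet_Ici]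
  refine integral_mono ((integrable_const (1 : ℝ)).indicator measurableSet_Ici)
    (integrable_ramp gauss κ (measurable_id.sub_const x)) fun z => ?_
  by_cases hz : z ∈ Set.Ici (x + κ)
  · have : x + κ ≤ z := hz
    simp only [Set.indicator_of_mem hz, Pi.one_apply]
    rw [ramp_of_le hκ (by linarith)]
  · simp only [Set.indicator_of_notMem hz]
    exact ramp_nonneg _ _

/-- The product of the two centered ramps of the differences of coordinates. -/
def rampProd (κ : ℝ) : BoundedContinuousFunction Space3 ℝ :=
  BoundedContinuousFunction.ofNormedAddCommGroup
    (fun p => (ramp κ (p.snd.fst - p.fst) - rampTail κ p.fst) *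
      (ramp κ (p.snd.snd - p.fst) - rampTail κ p.fst))
    (by
      have h1 := continuous_ramp κ
      have h2 := continuous_rampTail κ
      fun_prop) 1
    (by
      have key (x y : ℝ) : ‖ramp κ y - rampTail κ x‖ ≤ 1 := by
        rw [Real.norm_eq_abs, abs_sub_le_iff]
        constructor <;>
        linarith [ramp_nonneg κ y, ramp_le_one κ y, rampTail_nonneg κ x, rampTail_le_one κ x]
      intro p
      rw [norm_mul]
      exact mul_le_one₀ (key _ _) (norm_nonneg _) (key _ _))

lemma rampProd_apply (κ x y z : ℝ) :
    rampProd κ (WithLp.toLp 2 (x, WithLp.toLp 2 (y, z))) =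
      (ramp κ (y - x) - rampTail κ x) * (ramp κ (z - x) - rampTail κ x) := rfl

/-- Given the first coordinate, the other two are independent and `rampTail` is exactly the mean of
each ramp, so both factors integrate to zero. -/
lemma integral_rampProd_gauss3 (κ : ℝ) : ∫ p, rampProd κ p ∂gauss3 = 0 := by
  have : IsProbabilityMeasure ((gauss.prod gauss).map (WithLp.toLp 2)) :=
    Measure.isProbabilityMeasure_map (by fun_prop)
  have : IsProbabilityMeasure
    ((gauss.prod ((gauss.prod gauss).map (WithLp.toLp 2))).map (WithLp.toLp 2)) :=
    Measure.isProbabilityMeasure_map (by fun_prop)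
  have hi := (rampProd κ).integrable gauss3
  rw [gauss3] at hi ⊢
  replace hi : Integrable (fun q => rampProd κ (WithLp.toLp 2 q)) _ :=
    hi.comp_measurable (by fun_prop)
  rw [integral_map (by fun_prop) (rampProd κ).continuous.aestronglyMeasurable,
    integral_prod _ hi]
  refine integral_eq_zero_of_ae (.of_forall fun x => ?_)
  have hc : Continuous fun y : WithLp 2 (ℝ × ℝ) => rampProd κ (WithLp.toLp 2 (x, y)) := by
    have := (rampProd κ).continuous
    fun_prop
  simp only [Pi.zero_apply]
  rw [integral_map (by fun_prop) hc.aestronglyMeasurable]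
  have e : ∀ q : ℝ × ℝ, rampProd κ (WithLp.toLp 2 (x, WithLp.toLp 2 q)) =
    (ramp κ (q.1 - x) - rampTail κ x) * (ramp κ (q.2 - x) - rampTail κ x) := fun q => rfl
  have hr : Integrable (fun z => ramp κ (z - x)) gauss :=
    integrable_ramp gauss κ (measurable_id.sub_const x)
  simp_rw [e]
  rw [integral_prod_mul (fun y => ramp κ (y - x) - rampTail κ x)
    (fun y => ramp κ (y - x) - rampTail κ x),
    integral_sub hr (integrable_const _)]
  simp [rampTail]

/-! ### Concentration of the conditional rank around the Gaussian tail. -/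

section Rank

variable {Ω : Type*} [MeasurableSpace Ω] {μ : Measure Ω} [IsProbabilityMeasure μ]

/-- The conditional average of the ramp at the difference between the signed sum and the sum. -/
def rampRank {M : ℕ} (κ r : ℝ) (x : Fin M → ℝ) : ℝ :=
  ∫ B, ramp κ (r * signSum x B - r * ∑ m, x m) ∂(bitLaw M)

lemma rampRank_le {M : ℕ} {κ r : ℝ} (hκ : 0 < κ) (hr : 0 ≤ r) (x : Fin M → ℝ) :
    rampRank κ r x ≤ (bitLaw M).real {B | ∑ m, x m ≤ signSum x B} := by
  have hm : MeasurableSet {B : Fin M → Bool | ∑ m, x m ≤ signSum x B} :=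
    Set.Finite.measurableSet (Set.toFinite _)
  rw [← integral_indicator_one hm]
  refine integral_mono (integrable_ramp _ κ (measurable_of_countable _))
    ((integrable_const (1 : ℝ)).indicator hm) fun B => ?_
  by_cases hB : B ∈ {B : Fin M → Bool | ∑ m, x m ≤ signSum x B}
  · simp only [Set.indicator_of_mem hB, Pi.one_apply]
    exact ramp_le_one _ _
  · simp only [Set.indicator_of_notMem hB]
    have : signSum x B < ∑ m, x m := not_le.1 hB
    rw [ramp_of_nonpos hκ]
    nlinarith

/-- Given the data, the two sign vectors are independent with the same law, so the product
integrates to the square of one conditional mean. -/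
lemma integral_rampProd_jointLaw {M : ℕ} {x : Fin M → Ω → ℝ} (hx : ∀ m, Measurable (x m))
    (κ : ℝ) :
    ∫ p, rampProd κ p ∂(jointLaw μ x) =
      ∫ ω, (rampRank κ (√(totalVar μ x))⁻¹ (fun m => x m ω) -
        rampTail κ ((√(totalVar μ x))⁻¹ * ∑ m, x m ω)) ^ 2 ∂μ := by
  have := isProbabilityMeasure_jointLaw (μ := μ) hx
  have hi := (rampProd κ).integrable (jointLaw μ x)
  rw [jointLaw] at hi ⊢
  set r := (√(totalVar μ x))⁻¹
  have hmeas := measurable_jointVec hx r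
  replace hi : Integrable (fun p : Ω × ((Fin M → Bool) × (Fin M → Bool)) =>
      rampProd κ (jointVec r (fun m => x m p.1) p.2.1 p.2.2)) _ := hi.comp_measurable hmeas
  rw [integral_map hmeas.aemeasurable (rampProd κ).continuous.aestronglyMeasurable,
    integral_prod _ hi]
  refine integral_congr_ae (.of_forall fun ω => ?_)
  simp only [jointVec, rampProd_apply]
  rw [integral_prod_mul
    (fun B => ramp κ (r * signSum (fun m => x m ω) B - r * ∑ m, x m ω) -
      rampTail κ (r * ∑ m, x m ω))
    (fun B => ramp κ (r * signSum (fun m => x m ω) B - r * ∑ m, x m ω) -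
      rampTail κ (r * ∑ m, x m ω)),
    integral_sub (integrable_ramp _ κ (measurable_of_countable _)) (integrable_const _), sq]
  simp [rampRank]

lemma measurable_rampRank {M : ℕ} {x : Fin M → Ω → ℝ} (hx : ∀ m, Measurable (x m)) (κ r : ℝ) :
    Measurable fun ω => rampRank κ r (fun m => x m ω) := by
  have h1 : Measurable fun p : Ω × (Fin M → Bool) =>
      ramp κ (r * signSum (fun m => x m p.1) p.2 - r * ∑ m, x m p.1) := by
    refine (continuous_ramp κ).measurable.comp ?_
    exact ((measurable_signSum hx).const_mul r).sub
      ((Finset.measurable_sum _ fun m _ => (hx m).comp measurable_fst).const_mul r)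
  exact h1.stronglyMeasurable.integral_prod_right'.measurable

/-- `jointLaw` as a probability measure. -/
def jointProb (μ : Measure Ω) [IsProbabilityMeasure μ] {M : ℕ} (x : Fin M → Ω → ℝ)
    (hx : ∀ m, Measurable (x m)) : ProbabilityMeasure Space3 :=
  ⟨jointLaw μ x, isProbabilityMeasure_jointLaw hx⟩

/-- `gauss3` as a probability measure. -/
def gauss3Prob : ProbabilityMeasure Space3 := ⟨gauss3, inferInstance⟩

lemma tendsto_jointProb {θ : ∀ M : ℕ, Fin M → Ω → ℝ} {q K v : ℝ}
    (h : CenteredArray μ θ q K v) :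
    Tendsto (fun M => jointProb μ (θ M) (h.measurable M)) atTop (nhds gauss3Prob) :=
  ProbabilityMeasure.tendsto_of_tendsto_charFun fun t => tendsto_charFun_jointLaw h t

/-- The conditional probability that the signed sum reaches the sum is asymptotically at most as
concentrated near zero as the uniform distribution. -/
theorem eventually_measureReal_rank_le {θ : ∀ M : ℕ, Fin M → Ω → ℝ} {q K v : ℝ}
    (h : CenteredArray μ θ q K v) {a : ℝ} (ha : 0 ≤ a) {c : ℕ → ℝ}
    (hc : Tendsto c atTop (nhds 0)) {ε : ℝ} (hε : 0 < ε) :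
    ∀ᶠ M in atTop, μ.real {ω | (bitLaw M).real
      {B | ∑ m, θ M m ω ≤ signSum (fun m => θ M m ω) B} ≤ a + c M} ≤ a + ε := by
  have : NullSingletonClass gauss := nullSingletonClass_gaussianReal one_ne_zero
  -- `κ` is both the ramp width and the tolerance. The threshold `a + 2 * κ` leaves one `κ` for `c
  -- M` and one for the gap between smoothed rank and smoothed tail; Markov's inequality bounds the
  -- event of a larger gap.
  obtain ⟨κ, hκ, hlt⟩ := exists_measureReal_shift_lt gauss ha (half_pos hε)
  have hconv := tendsto_jointProb h
  let C : Set Space3 := {p | rampTail κ p.fst ≤ a + 2 * κ}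
  have hC : IsClosed C := isClosed_le
    ((continuous_rampTail κ).comp (by fun_prop)) continuous_const
  have hgC : gauss3 C < ENNReal.ofReal (a + ε / 2) := by
    have : IsProbabilityMeasure ((gauss.prod gauss).map (WithLp.toLp 2)) :=
      Measure.isProbabilityMeasure_map (by fun_prop)
    have e : gauss3 C = gauss {x | rampTail κ x ≤ a + 2 * κ} := by
      rw [gauss3, Measure.map_apply (by fun_prop) hC.measurableSet]
      have : WithLp.toLp 2 ⁻¹' C = {x | rampTail κ x ≤ a + 2 * κ} ×ˢ
        (Set.univ : Set (WithLp 2 (ℝ × ℝ))) := by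
        ext p; simp [C]
      rw [this, Measure.prod_prod, measure_univ, mul_one]
    rw [e]
    refine (measure_mono (t := {x | gauss.real (Set.Ici (x + κ)) ≤ a + 2 * κ}) fun x hx =>
      (measureReal_Ici_le_rampTail hκ x).trans hx).trans_lt ?_
    exact (ENNReal.lt_ofReal_iff_toReal_lt (measure_ne_top _ _)).2 hlt
  have ev1 : ∀ᶠ M in atTop, jointLaw μ (θ M) C < ENNReal.ofReal (a + ε / 2) := by
    have := ProbabilityMeasure.limsup_measure_closed_le_of_tendsto hconv hC
    exact eventually_lt_of_limsup_lt (this.trans_lt hgC)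
  have ev2 : ∀ᶠ M in atTop, ∫ p, rampProd κ p ∂(jointLaw μ (θ M)) < κ ^ 2 * (ε / 2) := by
    have := (ProbabilityMeasure.tendsto_iff_forall_integral_tendsto.1 hconv) (rampProd κ)
    have h0 : ∫ p, rampProd κ p ∂gauss3 = 0 := integral_rampProd_gauss3 κ
    simp only [gauss3Prob, jointProb, ProbabilityMeasure.coe_mk, h0] at this
    exact this.eventually_lt_const (by positivity)
  filter_upwards [ev1, ev2, hc.eventually_lt_const hκ] with M h1 h2 h3
  set r := (√(totalVar μ (θ M)))⁻¹ with hr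
  have hr0 : 0 ≤ r := by positivity
  let A : Set Ω := {ω | κ ^ 2 ≤ (rampRank κ r (fun m => θ M m ω) -
        rampTail κ (r * ∑ m, θ M m ω)) ^ 2}
  let A' : Set Ω := {ω | rampTail κ (r * ∑ m, θ M m ω) ≤ a + 2 * κ}
  have hsum : Measurable fun ω => ∑ m, θ M m ω :=
    Finset.measurable_sum _ fun m _ => h.measurable M m
  have hsub : {ω | (bitLaw M).real {B | ∑ m, θ M m ω ≤ signSum (fun m => θ M m ω) B} ≤ a + c M} ⊆
      A ∪ A' := by
    intro ω hω
    have h4 : (bitLaw M).real {B | ∑ m, θ M m ω ≤ signSum (fun m => θ M m ω) B} ≤ a + c M := hω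
    have h5 := rampRank_le hκ hr0 (fun m => θ M m ω)
    by_cases h6 : ω ∈ A'
    · exact Or.inr h6
    · left
      have h7 : a + 2 * κ < rampTail κ (r * ∑ m, θ M m ω) := not_le.1 h6
      change κ ^ 2 ≤ _
      nlinarith
  have hA : μ.real A ≤ ε / 2 := by
    rw [integral_rampProd_jointLaw (h.measurable M)] at h2
    have h01 (ω : Ω) : rampRank κ r (fun m => θ M m ω) ∈ Set.Icc (0 : ℝ) 1 := by
      refine ⟨integral_nonneg fun _ => ramp_nonneg _ _,
        (rampRank_le hκ hr0 _).trans measureReal_le_one⟩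
    have hmI : Measurable fun ω => (rampRank κ r (fun m => θ M m ω) -
        rampTail κ (r * ∑ m, θ M m ω)) ^ 2 :=
      ((measurable_rampRank (h.measurable M) κ r).sub
        ((continuous_rampTail κ).measurable.comp (hsum.const_mul r))).pow_const 2
    have hI : Integrable (fun ω => (rampRank κ r (fun m => θ M m ω) -
        rampTail κ (r * ∑ m, θ M m ω)) ^ 2) μ := by
      refine (integrable_const (1 : ℝ)).mono' hmI.aestronglyMeasurable (.of_forall fun ω => ?_)
      have := h01 ω
      have l1 := rampTail_nonneg κ (r * ∑ m, θ M m ω)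
      have l2 := rampTail_le_one κ (r * ∑ m, θ M m ω)
      rw [Real.norm_eq_abs, abs_of_nonneg (sq_nonneg _), sq_le_one_iff_abs_le_one, abs_sub_le_iff]
      constructor <;> linarith [this.1, this.2]
    have := mul_meas_ge_le_integral_of_nonneg (.of_forall fun ω => sq_nonneg _) hI (κ ^ 2)
    have h8 : κ ^ 2 * μ.real A ≤ κ ^ 2 * (ε / 2) := this.trans h2.le
    exact le_of_mul_le_mul_left h8 (by positivity)
  have hA' : μ.real A' ≤ a + ε / 2 := by
    have e : jointLaw μ (θ M) C = μ A' := by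
      rw [jointLaw, Measure.map_apply (measurable_jointVec (h.measurable M) _) hC.measurableSet]
      have : (fun p : Ω × ((Fin M → Bool) × (Fin M → Bool)) =>
          jointVec r (fun m => θ M m p.1) p.2.1 p.2.2) ⁻¹' C = A' ×ˢ Set.univ := by
        ext p; simp [C, A', jointVec]
      rw [← hr, this, Measure.prod_prod, measure_univ, mul_one]
    rw [e] at h1
    exact ENNReal.toReal_le_of_le_ofReal (by positivity) h1.le
  calc _ ≤ μ.real (A ∪ A') := measureReal_mono hsub
    _ ≤ μ.real A + μ.real A' := measureReal_union_le _ _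
    _ ≤ _ := by linarith

end Rank

/-! ### Algebra of the mosaic statistics -/

section Resid

variable {N T K M : ℕ} (c : Fin N → Fin M)

lemma clusterFrob_eq_inner (m : Fin M) (V W : Matrix (Fin N) (Fin T) ℝ) :
    clusterFrob c m V W = inner ℝ (clusterVec c m V) (clusterVec c m W) := by
  rw [PiLp.inner_apply, Fintype.sum_prod_type, clusterFrob,
    ← Finset.sum_subtype_of_mem (p := fun i => c i = m)
      (fun i => ∑ t, V i t * W i t) (by simp)]
  refine Finset.sum_congr (by ext i; simp [i.2]) fun i _ => Finset.sum_congr rfl fun t _ => ?_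
  rw [Real.inner_apply]
  rfl

lemma frob_eq_sum_clusterFrob (V W : Matrix (Fin N) (Fin T) ℝ) :
    frob V W = ∑ m, clusterFrob c m V W :=
  (Finset.sum_fiberwise _ c _).symm

lemma clusterFrob_comm (m : Fin M) (V W : Matrix (Fin N) (Fin T) ℝ) :
    clusterFrob c m V W = clusterFrob c m W V := by
  simp only [clusterFrob, mul_comm]

lemma clusterFrob_add_right (m : Fin M) (V W W' : Matrix (Fin N) (Fin T) ℝ) :
    clusterFrob c m V (W + W') = clusterFrob c m V W + clusterFrob c m V W' := by
  simp [clusterFrob, mul_add, Finset.sum_add_distrib]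

lemma clusterFrob_sub_right (m : Fin M) (V W W' : Matrix (Fin N) (Fin T) ℝ) :
    clusterFrob c m V (W - W') = clusterFrob c m V W - clusterFrob c m V W' := by
  simp [clusterFrob, mul_sub, Finset.sum_sub_distrib]

lemma clusterFrob_smul_right (m : Fin M) (a : ℝ) (V W : Matrix (Fin N) (Fin T) ℝ) :
    clusterFrob c m V (a • W) = a * clusterFrob c m V W := by
  simp [clusterFrob, Finset.mul_sum, mul_left_comm]

lemma clusterFrob_smul_left (m : Fin M) (a : ℝ) (V W : Matrix (Fin N) (Fin T) ℝ) :
    clusterFrob c m (a • V) W = a * clusterFrob c m V W := by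
  rw [clusterFrob_comm, clusterFrob_smul_right, clusterFrob_comm]

lemma clusterFrob_sub_left (m : Fin M) (V W W' : Matrix (Fin N) (Fin T) ℝ) :
    clusterFrob c m (W - W') V = clusterFrob c m W V - clusterFrob c m W' V := by
  rw [clusterFrob_comm, clusterFrob_sub_right, clusterFrob_comm c m V, clusterFrob_comm c m V]

lemma clusterFrob_sum_right {ι : Type*} (s : Finset ι) (m : Fin M)
    (V : Matrix (Fin N) (Fin T) ℝ) (W : ι → Matrix (Fin N) (Fin T) ℝ) :
    clusterFrob c m V (∑ k ∈ s, W k) = ∑ k ∈ s, clusterFrob c m V (W k) := by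
  classical
  induction s using Finset.induction_on with
  | empty => simp [clusterFrob]
  | insert a s ha ih => rw [Finset.sum_insert ha, Finset.sum_insert ha, clusterFrob_add_right, ih]

lemma clusterFrob_mul_left {P : Matrix (Fin T) (Fin T) ℝ} (hP : P.IsSymm) (m : Fin M)
    (V W : Matrix (Fin N) (Fin T) ℝ) :
    clusterFrob c m (V * P) W = clusterFrob c m V (W * P) := by
  refine Finset.sum_congr rfl fun i _ => ?_
  simp only [Matrix.mul_apply, Finset.sum_mul, Finset.mul_sum]
  rw [Finset.sum_comm]
  refine Finset.sum_congr rfl fun s _ => Finset.sum_congr rfl fun t _ => ?_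
  rw [← hP.apply s t]
  ring

lemma clusterVec_mosaicResid (P : Matrix (Fin T) (Fin T) ℝ)
    (X : Fin K → Matrix (Fin N) (Fin T) ℝ) (V : Matrix (Fin N) (Fin T) ℝ) (m : Fin M) :
    clusterVec c m (mosaicResid c P X V) = clusterResid c P X V m := by
  ext ⟨⟨i, rfl⟩, t⟩
  rfl

lemma clusterVec_mosaicResid_mem (P : Matrix (Fin T) (Fin T) ℝ)
    (X : Fin K → Matrix (Fin N) (Fin T) ℝ) (V : Matrix (Fin N) (Fin T) ℝ) (m : Fin M) :
    clusterVec c m (mosaicResid c P X V) ∈ (clusterDesign c P X m)ᗮ := by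
  rw [clusterVec_mosaicResid]
  exact Submodule.sub_starProjection_mem_orthogonal _

lemma clusterVec_mem_orthogonal_iff (P : Matrix (Fin T) (Fin T) ℝ)
    (X : Fin K → Matrix (Fin N) (Fin T) ℝ) (V : Matrix (Fin N) (Fin T) ℝ) (m : Fin M) :
    clusterVec c m V ∈ (clusterDesign c P X m)ᗮ ↔
      ∀ k, clusterFrob c m V (X k) = 0 ∧ clusterFrob c m V (X k * P) = 0 := by
  simp only [clusterFrob_eq_inner]
  rw [Submodule.mem_orthogonal']
  constructor
  · exact fun h k => ⟨h _ (Submodule.subset_span (Or.inl ⟨k, rfl⟩)),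
      h _ (Submodule.subset_span (Or.inr ⟨k, rfl⟩))⟩
  · intro h x hx
    induction hx using Submodule.span_induction with
    | mem x hx =>
      rcases hx with ⟨k, rfl⟩ | ⟨k, rfl⟩
      exacts [(h k).1, (h k).2]
    | zero => simp
    | add x y _ _ hx hy => rw [inner_add_right, hx, hy, add_zero]
    | smul a x _ hx => rw [inner_smul_right, hx, mul_zero]

lemma clusterFrob_mosaicRandomize_right (P : Matrix (Fin T) (Fin T) ℝ) (m : Fin M)
    (V W : Matrix (Fin N) (Fin T) ℝ) (B : Fin M → Bool) :
    clusterFrob c m V (mosaicRandomize c P W B) =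
      clusterFrob c m V (W * P ^ (B m).toNat) := by
  refine Finset.sum_congr rfl fun i hi => ?_
  rw [Finset.mem_filter] at hi
  simp [mosaicRandomize, hi.2]

end Resid

/-! ### The mosaic statistics as signed sums of cluster scores. -/

namespace PanelModel

variable {Ω : Type*} {M : ℕ} (d : PanelModel Ω M)

/-- The contribution of cluster `m` to `⟨D, ε⟩`. -/
def score (m : Fin M) (ω : Ω) : ℝ := clusterFrob d.cluster m d.D (d.ε ω)

/-- The contribution of cluster `m` to `⟨D, D⟩`. -/
def weight (m : Fin M) : ℝ := clusterFrob d.cluster m d.D d.D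

lemma weight_nonneg (m : Fin M) : 0 ≤ d.weight m := by
  rw [weight, clusterFrob_eq_inner]
  exact real_inner_self_nonneg

lemma frob_D_D : frob d.D d.D = ∑ m, d.weight m := frob_eq_sum_clusterFrob _ _ _

variable {d} (hPsymm : d.P.IsSymm) (hPinv : d.P ^ 2 = 1)

include hPinv in
lemma D_mul_P : d.D * d.P = -d.D := by
  rw [D, Matrix.smul_mul, Matrix.sub_mul, Matrix.mul_assoc, ← sq, hPinv, Matrix.mul_one,
    ← smul_neg, neg_sub]

include hPsymm hPinv in
lemma clusterFrob_D_mul_P (m : Fin M) (V : Matrix (Fin d.N) (Fin d.T) ℝ) :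
    clusterFrob d.cluster m d.D (V * d.P) = -clusterFrob d.cluster m d.D V := by
  rw [← clusterFrob_mul_left _ hPsymm, D_mul_P hPinv, ← neg_one_smul ℝ d.D,
    clusterFrob_smul_left, neg_one_mul]

include hPsymm hPinv in
lemma clusterFrob_D_mul_pow (m : Fin M) (V : Matrix (Fin d.N) (Fin d.T) ℝ) (b : Bool) :
    clusterFrob d.cluster m d.D (V * d.P ^ b.toNat) =
      bitSign b * clusterFrob d.cluster m d.D V := by
  cases b
  · simp [bitSign]
  · simp [bitSign, clusterFrob_D_mul_P hPsymm hPinv]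

include hPsymm hPinv in
lemma clusterFrob_D_mosaicRandomize (m : Fin M) (V : Matrix (Fin d.N) (Fin d.T) ℝ)
    (B : Fin M → Bool) :
    clusterFrob d.cluster m d.D (mosaicRandomize d.cluster d.P V B) =
      bitSign (B m) * clusterFrob d.cluster m d.D V := by
  rw [clusterFrob_mosaicRandomize_right, clusterFrob_D_mul_pow hPsymm hPinv]

include hPinv in
lemma mosaicRandomize_D (B : Fin M → Bool) (i : Fin d.N) (t : Fin d.T) :
    mosaicRandomize d.cluster d.P d.D B i t = bitSign (B (d.cluster i)) * d.D i t := by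
  rw [mosaicRandomize, Matrix.of_apply]
  cases B (d.cluster i)
  · simp [bitSign]
  · simp [bitSign, D_mul_P hPinv]

include hPinv in
lemma frob_mosaicRandomize_D (B : Fin M → Bool) :
    frob (mosaicRandomize d.cluster d.P d.D B) (mosaicRandomize d.cluster d.P d.D B) =
      frob d.D d.D := by
  refine Finset.sum_congr rfl fun i _ => Finset.sum_congr rfl fun t _ => ?_
  rw [mosaicRandomize_D hPinv]
  cases B (d.cluster i) <;> simp [bitSign]

include hPsymm hPinv in
-- Augmentation by the transformed controls is what makes this work: `A` is orthogonal to both `X k`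
-- and `X k * P`, and the symmetry of `P` moves it from `A * P` onto the controls.
lemma clusterVec_D_mem (m : Fin M) :
    clusterVec d.cluster m d.D ∈ (clusterDesign d.cluster d.P d.X m)ᗮ := by
  rw [clusterVec_mem_orthogonal_iff]
  have hA := (clusterVec_mem_orthogonal_iff d.cluster d.P d.X d.A m).1
    (clusterVec_mosaicResid_mem _ _ _ _ m)
  have h1 (k) : clusterFrob d.cluster m d.D (d.X k) = 0 := by
    rw [D, clusterFrob_smul_left, clusterFrob_sub_left, clusterFrob_mul_left _ hPsymm,
      (hA k).1, (hA k).2, sub_zero, mul_zero]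
  exact fun k => ⟨h1 k, by rw [clusterFrob_D_mul_P hPsymm hPinv, h1 k, neg_zero]⟩

include hPsymm hPinv in
lemma clusterFrob_D_mosaicResid (m : Fin M) (V : Matrix (Fin d.N) (Fin d.T) ℝ) :
    clusterFrob d.cluster m d.D (mosaicResid d.cluster d.P d.X V) =
      clusterFrob d.cluster m d.D V := by
  rw [clusterFrob_eq_inner, clusterFrob_eq_inner, clusterVec_mosaicResid, clusterResid,
    inner_sub_right]
  have := Submodule.inner_left_of_mem_orthogonal
    (Submodule.starProjection_apply_mem (clusterDesign d.cluster d.P d.X m)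
      (clusterVec d.cluster m V)) (clusterVec_D_mem hPsymm hPinv m)
  rw [this, sub_zero]

include hPsymm hPinv in
-- `D` sees `Z` only through its residual `A`, and oddness of `D` gives ⟨D, AP⟩ = -⟨D, A⟩.
lemma clusterFrob_D_Z (m : Fin M) : clusterFrob d.cluster m d.D d.Z = d.weight m := by
  rw [← clusterFrob_D_mosaicResid hPsymm hPinv, ← A, weight]
  conv_rhs => rw [show clusterFrob d.cluster m d.D d.D =
    clusterFrob d.cluster m d.D ((1 / 2 : ℝ) • (d.A - d.A * d.P)) from rfl]
  rw [clusterFrob_smul_right, clusterFrob_sub_right, clusterFrob_D_mul_P hPsymm hPinv]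
  ring

include hPsymm hPinv in
lemma clusterFrob_D_Y (m : Fin M) (ω : Ω) :
    clusterFrob d.cluster m d.D (d.Y ω) = d.β * d.weight m + d.score m ω := by
  have hX (k) : clusterFrob d.cluster m d.D (d.X k) = 0 :=
    ((clusterVec_mem_orthogonal_iff _ _ _ _ _).1 (clusterVec_D_mem hPsymm hPinv m) k).1
  rw [Y, clusterFrob_add_right, clusterFrob_add_right, clusterFrob_smul_right,
    clusterFrob_D_Z hPsymm hPinv, clusterFrob_sum_right]
  simp [clusterFrob_smul_right, hX, score]

include hPsymm hPinv in
-- One factor 2 comes from `A - A * P` being twice `D`, the other from the oddness of `D`.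
lemma thetaHat_eq (m : Fin M) (ω : Ω) : d.thetaHat m ω = 4 * d.score m ω := by
  have e : d.A - d.A * d.P = (2 : ℝ) • d.D := by
    rw [D, smul_smul]; norm_num
  have h : clusterFrob d.cluster m d.D (d.oracleResid ω) = d.score m ω := by
    rw [oracleResid, clusterFrob_D_mosaicResid hPsymm hPinv, clusterFrob_sub_right,
      clusterFrob_D_Y hPsymm hPinv, clusterFrob_smul_right, clusterFrob_D_Z hPsymm hPinv]
    ring
  rw [thetaHat, e, clusterFrob_smul_left, clusterFrob_smul_left,
    clusterFrob_D_mul_P hPsymm hPinv, h]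
  ring

include hPsymm hPinv in
lemma betaHat_eq (ω : Ω) :
    d.betaHat ω = (d.β * ∑ m, d.weight m + ∑ m, d.score m ω) / ∑ m, d.weight m := by
  rw [betaHat, S, frob_D_D, frob_eq_sum_clusterFrob d.cluster, resid]
  simp_rw [clusterFrob_D_mosaicResid hPsymm hPinv, clusterFrob_D_Y hPsymm hPinv]
  rw [Finset.sum_add_distrib, ← Finset.mul_sum]

include hPsymm hPinv in
lemma betaTilde_eq (ω : Ω) (B : Fin M → Bool) :
    d.betaTilde ω B = (d.β * signSum d.weight B + signSum (fun m => d.score m ω) B) /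
      ∑ m, d.weight m := by
  rw [betaTilde, S, frob_D_D, frob_eq_sum_clusterFrob d.cluster, resid]
  simp_rw [clusterFrob_D_mosaicRandomize hPsymm hPinv, clusterFrob_D_mosaicResid hPsymm hPinv,
    clusterFrob_D_Y hPsymm hPinv]
  rw [signSum, signSum, Finset.mul_sum, ← Finset.sum_add_distrib]
  congr 1
  exact Finset.sum_congr rfl fun m _ => by ring

include hPsymm hPinv in
lemma rhoTilde_eq (B : Fin M → Bool) :
    d.rhoTilde B = signSum d.weight B / ∑ m, d.weight m := by
  rw [rhoTilde, frob_mosaicRandomize_D hPinv, frob_D_D, Real.sqrt_mul_self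
    (Finset.sum_nonneg fun m _ => d.weight_nonneg m), frob_eq_sum_clusterFrob d.cluster]
  simp_rw [clusterFrob_D_mosaicRandomize hPsymm hPinv]
  rfl

include hPsymm hPinv in
/-- The distance from `β - β̂` to the randomized statistic has the sign of the difference between
the sum of the scores and its signed version. -/
lemma randomized_sub_eq (hw : 0 < ∑ m, d.weight m) (ω : Ω) (B : Fin M → Bool)
    (hρ : d.rhoTilde B < 1) :
    (d.rhoTilde B * d.betaHat ω - d.betaTilde ω B) / (1 - d.rhoTilde B) - (d.β - d.betaHat ω) =
      (∑ m, d.score m ω - signSum (fun m => d.score m ω) B) /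
        ((∑ m, d.weight m) * (1 - d.rhoTilde B)) := by
  have h1 : 1 - d.rhoTilde B ≠ 0 := by linarith
  have h2 : d.betaTilde ω B = d.β * d.rhoTilde B +
      signSum (fun m => d.score m ω) B / ∑ m, d.weight m := by
    rw [betaTilde_eq hPsymm hPinv, rhoTilde_eq hPsymm hPinv]; ring
  rw [h2, betaHat_eq hPsymm hPinv]
  field_simp
  ring

include hPsymm hPinv in
lemma rhoTilde_lt_one (hw : ∀ m, 0 < d.weight m) {B : Fin M → Bool} (hB : B ≠ fun _ => false) :
    d.rhoTilde B < 1 := by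
  obtain ⟨m, hm⟩ := Function.ne_iff.1 hB
  have hm' : B m = true := by simpa using hm
  have hpos : 0 < ∑ m, d.weight m :=
    Finset.sum_pos (fun m _ => hw m) ⟨m, Finset.mem_univ m⟩
  rw [rhoTilde_eq hPsymm hPinv, div_lt_one hpos]
  refine Finset.sum_lt_sum (fun i _ => ?_) ⟨m, Finset.mem_univ m, ?_⟩
  · have := hw i
    cases B i
    · simp [bitSign]
    · simp [bitSign]; linarith
  · have := hw m
    rw [hm']; simp [bitSign]; linarith

end PanelModel

/-! ### From a missed endpoint to a small conditional rank. -/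

lemma bitLaw_real_singleton {M : ℕ} (B : Fin M → Bool) :
    (bitLaw M).real {B} = (1 / 2) ^ M := by
  rw [measureReal_def, bitLaw, Measure.pi_singleton, ENNReal.toReal_prod]
  have h (b : Bool) : ((bernoulliMeasure true false ⟨1 / 2, by norm_num, by norm_num⟩ :
      Measure Bool) {b}).toReal = 1 / 2 := by
    rw [← measureReal_def, bernoulliMeasure_real_apply _ (measurableSet_singleton b)]
    cases b <;> simp
    norm_num
  simp_rw [h]
  simp

namespace PanelModel

variable {Ω : Type*} {M : ℕ} {d : PanelModel Ω M} (hPsymm : d.P.IsSymm) (hPinv : d.P ^ 2 = 1)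

include hPsymm hPinv in
lemma measureReal_le_of_lt_add_qlo (hM : 0 < M) (hw : ∀ m, 0 < d.weight m) {ω : Ω} {p q : ℝ}
    (hq : IsQuantile (d.condLaw ω) p q) (hlt : d.β < d.betaHat ω + q) :
    (bitLaw M).real {B | ∑ m, d.score m ω ≤ signSum (fun m => d.score m ω) B} ≤
      p + (1 / 2) ^ M := by
  have hpos : 0 < ∑ m, d.weight m := Finset.sum_pos (fun m _ => hw m) ⟨⟨0, hM⟩, Finset.mem_univ _⟩
  have h1 := hq.1
  rw [condLaw, measureReal_def, Measure.map_apply (measurable_of_countable _) measurableSet_Iio,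
    ← measureReal_def] at h1
  refine (measureReal_mono (s₂ := ((fun B => (d.rhoTilde B * d.betaHat ω - d.betaTilde ω B) /
    (1 - d.rhoTilde B)) ⁻¹' Set.Iio q) ∪ {fun _ => false}) fun B hB => ?_).trans
    ((measureReal_union_le _ _).trans (add_le_add h1 (bitLaw_real_singleton _).le))
  -- With all bits zero, `rhoTilde` is 1 and the fraction is 0 by convention, unrelated to the
  -- scores. This single atom costs 2^{-M}.
  by_cases hB0 : B = fun _ => false
  · exact Or.inr hB0
  · left
    have hρ := rhoTilde_lt_one hPsymm hPinv hw hB0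
    have h2 := randomized_sub_eq hPsymm hPinv hpos ω B hρ
    have h3 : (∑ m, d.score m ω - signSum (fun m => d.score m ω) B) /
        ((∑ m, d.weight m) * (1 - d.rhoTilde B)) ≤ 0 :=
      div_nonpos_of_nonpos_of_nonneg (sub_nonpos.2 hB) (mul_nonneg hpos.le (by linarith))
    simp only [Set.mem_preimage, Set.mem_Iio]
    linarith

include hPsymm hPinv in
lemma measureReal_le_of_add_qhi_lt (hM : 0 < M) (hw : ∀ m, 0 < d.weight m) {ω : Ω} {p q : ℝ}
    (hq : IsQuantile (d.condLaw ω) p q) (hlt : d.betaHat ω + q < d.β) :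
    (bitLaw M).real {B | signSum (fun m => d.score m ω) B ≤ ∑ m, d.score m ω} ≤
      (1 - p) + (1 / 2) ^ M := by
  have hpos : 0 < ∑ m, d.weight m := Finset.sum_pos (fun m _ => hw m) ⟨⟨0, hM⟩, Finset.mem_univ _⟩
  have h1 := hq.2
  have hms : MeasurableSet ((fun B => (d.rhoTilde B * d.betaHat ω - d.betaTilde ω B) /
      (1 - d.rhoTilde B)) ⁻¹' Set.Iic q) := Set.Finite.measurableSet (Set.toFinite _)
  rw [condLaw, measureReal_def, Measure.map_apply (measurable_of_countable _) measurableSet_Iic,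
    ← measureReal_def] at h1
  -- The quantile bounds the closed lower tail from below, so the upper endpoint is handled through
  -- the complement, of mass at most `1 - p`.
  have h4 := probReal_compl_eq_one_sub (μ := bitLaw M) hms
  refine (measureReal_mono (s₂ := ((fun B => (d.rhoTilde B * d.betaHat ω - d.betaTilde ω B) /
    (1 - d.rhoTilde B)) ⁻¹' Set.Iic q)ᶜ ∪ {fun _ => false}) fun B hB => ?_).trans
    ((measureReal_union_le _ _).trans (add_le_add (by linarith) (bitLaw_real_singleton _).le))
  by_cases hB0 : B = fun _ => false
  · exact Or.inr hB0
  · left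
    have hρ := rhoTilde_lt_one hPsymm hPinv hw hB0
    have h2 := randomized_sub_eq hPsymm hPinv hpos ω B hρ
    have h3 : 0 ≤ (∑ m, d.score m ω - signSum (fun m => d.score m ω) B) /
        ((∑ m, d.weight m) * (1 - d.rhoTilde B)) :=
      div_nonneg (sub_nonneg.2 hB) (mul_nonneg hpos.le (by linarith))
    simp only [Set.mem_compl_iff, Set.mem_preimage, Set.mem_Iic, not_le]
    linarith

/-! ### The scores are measurable, centered and independent. -/

section Probability

variable [MeasurableSpace Ω] {μ : Measure Ω}

lemma measurable_score (hmeas : ∀ i t, Measurable fun ω => d.ε ω i t) (m : Fin M) :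
    Measurable (d.score m) := by
  change Measurable fun ω => ∑ i with d.cluster i = m, ∑ t, d.D i t * d.ε ω i t
  exact Finset.measurable_sum _ fun i _ => Finset.measurable_sum _ fun t _ =>
    (hmeas i t).const_mul _

lemma integral_score (hzero : d.MeanZero μ) (m : Fin M) : ∫ ω, d.score m ω ∂μ = 0 := by
  have h (i) (t) : Integrable (fun ω => d.D i t * d.ε ω i t) μ := (hzero i t).1.const_mul _
  change ∫ ω, ∑ i with d.cluster i = m, ∑ t, d.D i t * d.ε ω i t ∂μ = 0
  rw [integral_finsetSum _ fun i _ => integrable_finsetSum _ fun t _ => h i t]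
  refine Finset.sum_eq_zero fun i _ => ?_
  rw [integral_finsetSum _ fun t _ => h i t]
  refine Finset.sum_eq_zero fun t _ => ?_
  rw [integral_const_mul, (hzero i t).2, mul_zero]

lemma iIndepFun_score (hindep : d.ClusterIndep μ) : iIndepFun d.score μ := by
  have := hindep.comp (fun m (x : {i : Fin d.N // d.cluster i = m} × Fin d.T → ℝ) =>
    inner ℝ (clusterVec d.cluster m d.D) (WithLp.toLp 2 x)) fun m => by fun_prop
  refine this.congr fun m => .of_forall fun ω => ?_
  simp only [Function.comp, score, clusterFrob_eq_inner]
  rfl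

end Probability

end PanelModel

/-! ### Coverage -/

section Coverage

variable {Ω : Type*} [MeasurableSpace Ω] {μ : Measure Ω}

lemma CenteredArray.neg {θ : ∀ M : ℕ, Fin M → Ω → ℝ} {q K v : ℝ}
    (h : CenteredArray μ θ q K v) : CenteredArray μ (fun M m ω => -θ M m ω) q K v where
  measurable M m := (h.measurable M m).neg
  indep M := (h.indep M).comp (fun _ x => -x) fun _ => measurable_neg
  mean M m := by rw [integral_neg, h.mean, neg_zero]
  q_pos := h.q_pos
  q_le := h.q_le
  integrable M m := by simpa using h.integrable M m
  moment_le M m := by simpa using h.moment_le M m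
  v_pos := h.v_pos
  le_var M m := by simpa using h.le_var M m

lemma signSum_neg {M : ℕ} (x : Fin M → ℝ) (B : Fin M → Bool) :
    signSum (fun m => -x m) B = -signSum x B := by
  simp [signSum]

lemma signSum_mul {M : ℕ} (a : ℝ) (x : Fin M → ℝ) (B : Fin M → Bool) :
    signSum (fun m => a * x m) B = a * signSum x B := by
  simp [signSum, Finset.mul_sum, mul_left_comm]

variable [IsProbabilityMeasure μ]

lemma exists_centeredArray {d : ∀ M : ℕ, PanelModel Ω M}
    (hmeas : ∀ M i t, Measurable fun ω => (d M).ε ω i t)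
    (hPsymm : ∀ M, (d M).P.IsSymm) (hPinv : ∀ M, (d M).P ^ 2 = 1)
    (hzero : ∀ M, (d M).MeanZero μ) (hindep : ∀ M, (d M).ClusterIndep μ)
    (hlyap : Lyapunov μ d) :
    ∃ q K v, CenteredArray μ (fun M => (d M).thetaHat) q K v := by
  obtain ⟨δ, hδ, δ₁, hδ₁, -, ⟨b, hb⟩, v, hv, hvar⟩ := hlyap
  have e (M) : (d M).thetaHat = fun m ω => 4 * (d M).score m ω := by
    ext m ω; exact PanelModel.thetaHat_eq (hPsymm M) (hPinv M) m ω
  have hθ (M m) : Measurable ((d M).thetaHat m) := by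
    rw [e]; exact (PanelModel.measurable_score (hmeas M) m).const_mul 4
  have h0 (M m) : ∫ ω, (d M).thetaHat m ω ∂μ = 0 := by
    rw [e]; rw [integral_const_mul, PanelModel.integral_score (hzero M), mul_zero]
  have hle (x : ℝ) : |x| ^ (2 + min 1 δ₁) ≤ 1 + |x| ^ (2 + δ₁) := by
    have hpos : 0 ≤ |x| ^ (2 + δ₁) := by positivity
    rcases le_total |x| 1 with h | h
    · have : |x| ^ (2 + min 1 δ₁) ≤ 1 := Real.rpow_le_one (abs_nonneg x) h
        (by have : 0 < min 1 δ₁ := lt_min one_pos (hδ.trans hδ₁)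
            linarith)
      linarith
    · have : |x| ^ (2 + min 1 δ₁) ≤ |x| ^ (2 + δ₁) :=
        Real.rpow_le_rpow_of_exponent_le h (by have := min_le_right 1 δ₁; linarith)
      linarith
  have hint (M m) : Integrable (fun ω => |(d M).thetaHat m ω| ^ (2 + min 1 δ₁)) μ := by
    refine ((integrable_const (1 : ℝ)).add (hb M m).1).mono'
      ((hθ M m).abs.pow_const _).aestronglyMeasurable (.of_forall fun ω => ?_)
    rw [Real.norm_eq_abs, abs_of_nonneg (by positivity)]
    exact hle _
  -- The order is truncated at 3 for the Taylor bound; the lower power is dominated by 1 plus the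
  -- higher one, whence `1 + b`.
  refine ⟨min 1 δ₁, 1 + b, v, hθ, fun M => ?_, h0, lt_min one_pos (hδ.trans hδ₁),
    min_le_left _ _, hint, fun M m => ?_, hv, fun M m => ?_⟩
  · rw [e]
    exact (PanelModel.iIndepFun_score (hindep M)).comp (fun _ x => 4 * x)
      fun _ => measurable_const_mul 4
  · refine (integral_mono (hint M m) ((integrable_const (1 : ℝ)).add (hb M m).1)
      fun ω => hle _).trans ?_
    have : ∫ ω, (1 + |(d M).thetaHat m ω| ^ (2 + δ₁)) ∂μ =
        1 + ∫ ω, |(d M).thetaHat m ω| ^ (2 + δ₁) ∂μ := by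
      rw [integral_add (integrable_const _) (hb M m).1]; simp
    exact this.trans_le (add_le_add_right (hb M m).2 1)
  · rw [← variance_of_integral_eq_zero (hθ M m).aemeasurable (h0 M m)]
    exact hvar M m

omit [IsProbabilityMeasure μ] in
-- A zero weight would make `D` vanish on the cluster, and the cluster statistic with it.
lemma PanelModel.weight_pos {M : ℕ} {d : PanelModel Ω M} (hPsymm : d.P.IsSymm)
    (hPinv : d.P ^ 2 = 1) {m : Fin M} (h : 0 < ∫ ω, d.thetaHat m ω ^ 2 ∂μ) : 0 < d.weight m := by
  refine (d.weight_nonneg m).lt_of_ne fun h0 => h.ne' ?_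
  rw [weight, clusterFrob_eq_inner, eq_comm, inner_self_eq_zero] at h0
  have hθ (ω) : d.thetaHat m ω = 0 := by
    rw [thetaHat_eq hPsymm hPinv, score, clusterFrob_eq_inner, h0, inner_zero_left, mul_zero]
  simp [hθ]

end Coverage

end Mosaic

end

open Mosaic in
theorem mainTheorem5 {Ω : Type*} [MeasurableSpace Ω] (μ : Measure Ω) [IsProbabilityMeasure μ]
    (d : ∀ M : ℕ, Mosaic.PanelModel Ω M)
    (hmeas : ∀ M i t, Measurable fun ω => (d M).ε ω i t)
    (hPsymm : ∀ M, (d M).P.IsSymm) (hPinv : ∀ M, (d M).P ^ 2 = 1)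
    (hzero : ∀ M, (d M).MeanZero μ) (hindep : ∀ M, (d M).ClusterIndep μ)
    (hlyap : Mosaic.Lyapunov μ d)
    (α : ℝ) (hα₀ : 0 < α) (hα₁ : α < 1)
    (qlo qhi : ℕ → Ω → ℝ) (hqlo_meas : ∀ M, Measurable (qlo M))
    (hqhi_meas : ∀ M, Measurable (qhi M))
    (hqlo : ∀ M ω, Mosaic.IsQuantile ((d M).condLaw ω) (α / 2) (qlo M ω))
    (hqhi : ∀ M ω, Mosaic.IsQuantile ((d M).condLaw ω) (1 - α / 2) (qhi M ω)) :
    1 - α ≤ liminf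
      (fun M => μ.real {ω | (d M).β ∈ (d M).mosaicCI ω (qlo M ω) (qhi M ω)}) atTop := by
  obtain ⟨q, K, v, harr⟩ := exists_centeredArray hmeas hPsymm hPinv hzero hindep hlyap
  have hc : Tendsto (fun M : ℕ => ((1 : ℝ) / 2) ^ M) atTop (nhds 0) :=
    tendsto_pow_atTop_nhds_zero_of_lt_one (by norm_num) (by norm_num)
  refine le_of_forall_pos_sub_le fun ε hε => ?_
  refine le_liminf_of_le (isBoundedUnder_of ⟨1, fun M => measureReal_le_one⟩).isCoboundedUnder_ge ?_
  filter_upwards [eventually_measureReal_rank_le harr (half_pos hα₀).le hc (half_pos hε),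
    eventually_measureReal_rank_le harr.neg (half_pos hα₀).le hc (half_pos hε),
    eventually_gt_atTop 0] with M h1 h2 hM
  have hw (m : Fin M) : 0 < (d M).weight m :=
    PanelModel.weight_pos (μ := μ) (hPsymm M) (hPinv M) (harr.v_pos.trans_le (harr.le_var M m))
  -- The rank is unchanged by the common positive factor 4, so the bounds pass from the cluster
  -- statistics to the scores.
  simp_rw [PanelModel.thetaHat_eq (hPsymm M) (hPinv M), signSum_mul, ← Finset.mul_sum] at h1
  simp_rw [signSum_neg, PanelModel.thetaHat_eq (hPsymm M) (hPinv M), signSum_mul,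
    Finset.sum_neg_distrib, ← Finset.mul_sum, neg_le_neg_iff] at h2
  simp only [mul_le_mul_iff_right₀ (four_pos (α := ℝ))] at h1 h2
  set E := {ω | (d M).β ∈ (d M).mosaicCI ω (qlo M ω) (qhi M ω)}
  -- Covering the whole space gives the lower bound on the measure of `E` from subadditivity alone,
  -- without measurability of the three events.
  have hcov : Set.univ ⊆ E ∪ ({ω | (bitLaw M).real {B | ∑ m, (d M).score m ω ≤
      signSum (fun m => (d M).score m ω) B} ≤ α / 2 + (1 / 2) ^ M} ∪
      {ω | (bitLaw M).real {B | signSum (fun m => (d M).score m ω) B ≤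
        ∑ m, (d M).score m ω} ≤ α / 2 + (1 / 2) ^ M}) := by
    intro ω _
    by_cases hlo : (d M).betaHat ω + qlo M ω ≤ (d M).β
    · by_cases hhi : (d M).β ≤ (d M).betaHat ω + qhi M ω
      · exact Or.inl ⟨hlo, hhi⟩
      · have := PanelModel.measureReal_le_of_add_qhi_lt (hPsymm M) (hPinv M) hM hw (hqhi M ω)
          (not_le.1 hhi)
        rw [sub_sub_cancel] at this
        exact Or.inr (Or.inr this)
    · exact Or.inr (Or.inl (PanelModel.measureReal_le_of_lt_add_qlo (hPsymm M) (hPinv M) hM hw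
        (hqlo M ω) (not_le.1 hlo)))
  have h3 := (measureReal_mono (μ := μ) hcov).trans ((measureReal_union_le _ _).trans
    (add_le_add_right ((measureReal_union_le _ _).trans (add_le_add h1 h2)) _))
  rw [probReal_univ] at h3
  linarith
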